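/- Let $\nu\ge 2$. For integers $k_1,\dots,k_\nu>1$ and positive numbers $\beta_{ij}$ ($1\le i\le\nu$, $1\le j\le k_i$) with $\sum_j\beta_{ij}=N$ for every $i$, let $P\subset\mathbb R^{k_1\cdots k_\nu}$ be the $\nu$-index transportation polytope of non-negative $k_1\times\dots\times k_\nu$ arrays $x=(\xi_{j_1\dots j_\nu})$ satisfying the equations $$\sum_{(j_1,\dots,j_\nu):\,j_i=j}\xi_{j_1\dots j_\nu}=\beta_{ij}\quad(1\le i\le\nu,\ 1\le j\le k_i-1),\qquad \sum_{j_1,\dots,j_\nu}\xi_{j_1\dots j_\nu}=N .$$ Let $A$ be the matrix of this system. It has $d=k_1+\dots+k_\nu-\nu+1$ rows; denote its columns by $a_J$, $J=(j_1,\dots,j_\nu)$. Let $z=(\zeta_J)$ be the point of $P$ maximizing $f(x)=k_1\cdots k_\nu+\sum_J\ln\xi_J$ on $P$ (where $\ln 0=-\infty$), let $B$ be the matrix with columns $\zeta_Ja_J$, and let $q(t)=\frac12\sum_J\zeta_J^2\langle a_J,t\rangle^2$ for $t\in\mathbb R^d$. Write $\operatorname{vol}P$ for the $(k_1\cdots k_\nu-d)$-dimensional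 volume of $P$ with respect to the Lebesgue measure induced on its affine hull by the Euclidean structure of $\mathbb R^{k_1\cdots k_\nu}$. Fix real numbers $a,b,\delta,\Delta$ with $a,\delta>0$. For a positive integer $n$, let $\mathcal P_n$ be the class of all such polytopes $P$ with $an\le k_i\le bn$ for all $i$ and $\delta\le\zeta_J\le\Delta$ for all $J$. (1) There are constants $c,C>0$, depending only on $\nu,a,b,\delta,\Delta$, such that for every $n$ and every $P\in\mathcal P_n$ the smallest eigenvalue $\lambda$ of $q$ satisfies $c\,n^{\nu-2}\le\lambda\le C\,n^{\nu-2}$. (2) If $\nu\ge5$, then the Gaussian formula $$G(P)=\frac1{(2\pi)^{d/2}}\left(\frac{\det AA^T}{\det BB^T}\right)^{1/2}e^{f(z)}$$ gives the volume with relative error tending to $0$, uniformly: for every $\varepsilon>0$ there is $n_0$ such that $|G(P)-\operatorname{vol}P|\le\varepsilon\operatorname{vol}P$ for all $n\ge n_0$ and all $P\in\mathcal P_n$. (3) Let $P_k$ be the dilated polytope of polystochastic tensors, that is, of $k\times\dots\times k$ ($\nu$ factors) arrays of non-negative numbers with all sums along the coordinate hyperplanes $\{j_i=j\}$ equal to $k^{\nu-1}$.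 For every $k>1$ the array with all entries $1$ maximizes $\sum_J\ln\xi_J$ on $P_k$, and, if $\nu\ge5$, $$\operatorname{vol}P_k=(1+o(1))\,\frac{e^{k^\nu}}{(2\pi)^{(\nu k-\nu+1)/2}}\qquad\text{as }k\to+\infty .$$ -/

import Mathlib

open MeasureTheory Filter Topology Matrix

noncomputable section

namespace GaussVol

section General

variable {R ι : Type*} [Fintype R] [Fintype ι]

/-- The polyhedron `{x : A x = b, x ≥ 0}` in the Euclidean space of vectors indexed by `ι`. -/
def polyhedron (A : Matrix R ι ℝ) (b : R → ℝ) : Set (EuclideanSpace ℝ ι) :=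
  {x | (∀ r, ∑ j, A r j * x j = b r) ∧ ∀ j, 0 ≤ x j}

/-- The entropy function `f(x) = n + ∑ ln ξ_j`, with `n` the number of coordinates. -/
def entropy (x : EuclideanSpace ℝ ι) : ℝ :=
  Fintype.card ι + ∑ j, Real.log (x j)

/-- `z` maximizes `f(x) = n + ∑ ln ξ_j` on `P`. Since `ln 0 = -∞`, the points of `P` with a zero
coordinate do not compete; they are left out because `Real.log 0 = 0`. -/
def IsAnalyticCenter (P : Set (EuclideanSpace ℝ ι)) (z : EuclideanSpace ℝ ι) : Prop :=
  z ∈ P ∧ (∀ j, 0 < z j) ∧ ∀ x ∈ P, (∀ j, 0 < x j) → entropy x ≤ entropy z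

/-- The matrix `B` with columns `ζ_j a_j`, where `a_j` are the columns of `A`. -/
def scaledMatrix (A : Matrix R ι ℝ) (z : EuclideanSpace ℝ ι) : Matrix R ι ℝ :=
  Matrix.of fun r j => z j * A r j

/-- The quadratic form `q(t) = (1/2) ∑ ζ_j² ⟨a_j, t⟩²`. -/
def momentForm (A : Matrix R ι ℝ) (z : EuclideanSpace ℝ ι) : QuadraticForm ℝ (R → ℝ) :=
  ∑ j, (z j ^ 2 / 2) •
    QuadraticMap.linMulLin (LinearMap.proj j ∘ₗ Aᵀ.mulVecLin) (LinearMap.proj j ∘ₗ Aᵀ.mulVecLin)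

theorem momentForm_apply (A : Matrix R ι ℝ) (z : EuclideanSpace ℝ ι) (t : R → ℝ) :
    momentForm A z t = 1 / 2 * ∑ j, z j ^ 2 * (∑ r, A r j * t r) ^ 2 := by
  simp only [momentForm, _root_.sum_apply, _root_.smul_apply, smul_eq_mul]
  rw [Finset.mul_sum]
  refine Finset.sum_congr rfl fun j _ => ?_
  have h : (LinearMap.proj j ∘ₗ Aᵀ.mulVecLin : (R → ℝ) →ₗ[ℝ] ℝ) t = ∑ r, A r j * t r := rfl
  rw [QuadraticMap.linMulLin_apply, h]
  ring

/-- `l` is the smallest eigenvalue of the quadratic form `Q`, that is, of its symmetric Gram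
matrix in the standard basis. -/
def IsSmallestEigenvalue [DecidableEq R] (Q : QuadraticForm ℝ (R → ℝ)) (l : ℝ) : Prop :=
  IsLeast {μ : ℝ | Module.End.HasEigenvalue (Matrix.toLin' Q.toMatrix') μ} l

/-- The Gaussian formula `(2π)^{-d/2} (det A Aᵀ / det B Bᵀ)^{1/2} e^{f(z)}`, with `d` the number of
rows of `A`. -/
def gaussianFormula [DecidableEq R] (A : Matrix R ι ℝ) (z : EuclideanSpace ℝ ι) : ℝ :=
  1 / (2 * Real.pi) ^ ((Fintype.card R : ℝ) / 2) *
    Real.sqrt ((A * Aᵀ).det / (scaledMatrix A z * (scaledMatrix A z)ᵀ).det) *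
    Real.exp (entropy z)

/-- The `m`-dimensional Euclidean volume of a subset of a Euclidean space. On an `m`-dimensional
affine subspace this is the induced Lebesgue measure. -/
def vol (m : ℕ) (S : Set (EuclideanSpace ℝ ι)) : ℝ :=
  (μHE[m] S).toReal

end General

/-- The positions `(j_1, …, j_ν)` in a `k_1 × … × k_ν` array. -/
abbrev Cell {ν : ℕ} (k : Fin ν → ℕ) : Type := (i : Fin ν) → Fin (k i)

/-- The equations of a transportation polytope: `some ⟨i, j⟩` is the `j`-th sectional sum in
direction `i`, for all `j` but the last one; `none` is the total sum. -/
abbrev Eqn {ν : ℕ} (k : Fin ν → ℕ) : Type :=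
  Option ((i : Fin ν) × {j : Fin (k i) // (j : ℕ) + 1 < k i})

/-- The matrix of the system: sectional sums and the total sum. -/
def sectionMatrix {ν : ℕ} (k : Fin ν → ℕ) : Matrix (Eqn k) (Cell k) ℝ :=
  Matrix.of fun e J =>
    match e with
    | none => 1
    | some ⟨i, j⟩ => if J i = j.1 then 1 else 0

/-- The right hand side of the system. -/
def sectionRhs {ν : ℕ} (k : Fin ν → ℕ) (N : ℝ) (β : (i : Fin ν) → Fin (k i) → ℝ) : Eqn k → ℝ
  | none => N
  | some ⟨i, j⟩ => β i j.1

/-- The `ν`-index transportation polytope of nonnegative `k_1 × … × k_ν` arrays with sectional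
sums `β i j` and total sum `N`. -/
def transportPolytope {ν : ℕ} (k : Fin ν → ℕ) (N : ℝ) (β : (i : Fin ν) → Fin (k i) → ℝ) :
    Set (EuclideanSpace ℝ (Cell k)) :=
  polyhedron (sectionMatrix k) (sectionRhs k N β)

/-- The dilated polytope of polystochastic tensors: nonnegative `k × … × k` arrays (`ν` indices)
all of whose sums along coordinate hyperplanes are `k ^ (ν - 1)`. -/
def polystochastic (ν k : ℕ) : Set (EuclideanSpace ℝ (Fin ν → Fin k)) :=
  {x | (∀ J, 0 ≤ x J) ∧
    ∀ (i : Fin ν) (j : Fin k),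
      ∑ J ∈ Finset.univ.filter (fun J : Fin ν → Fin k => J i = j), x J = (k : ℝ) ^ (ν - 1)}

end GaussVol

end

/-!
Split the array space into the kernel of `A` and its orthogonal complement. In the corresponding
coordinates `e^{-f(z)} vol P` is, up to the factor `√det(AAᵀ)`, the density at `b` of `A x`, where
the entries of `x` are independent exponential variables of means `ζ_J`: the first-order condition
for the maximum of the entropy makes the density of `x` constant on `P`. Fourier inversion turns it
into `∫ ∏ e^{iu_J} / (1 + iu_J)` with `u_J = 2π ζ_J ⟨a_J, ξ⟩`, whereas the Gaussian formula is the
same expression with the integrand replaced by `e^{-Q}`, `Q = ½ ∑ u_J²`.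

The two integrands are compared through a leverage bound `u_J² ≤ κ Q`. It gives the pointwise
estimate `|∏ e^{iu_J} / (1 + iu_J) - e^{-Q}| ≤ ∑ |u_J|³ (1 + κ Q)^{-1/κ}`, and the right-hand side,
being a Gamma mixture of centred Gaussians, is integrated through the cubic moments of a Gaussian.
The relative error is of order `#J · κ^{3/2}` as long as `d² κ` is small. For transportation
polytopes the array `⟨a_J, t⟩` is the orthogonal sum of a constant and of centred functions of one
index each, which yields `κ = O(n^{1 - ν})` and also the smallest eigenvalue of `q`. Since
`d = O(n)` and `#J = O(n^ν)`, both conditions reduce to `n^{3 - ν} → 0`.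
-/

noncomputable section

namespace GaussVol

section Scalar

/-- The logarithm of the characteristic function of a centered exponential variable of mean `1`,
at `-u`. -/
def logChar (u : ℝ) : ℂ := Complex.I * u - Complex.log (1 + Complex.I * u)

theorem one_add_I_mul_mem_slitPlane (u : ℝ) : (1 + Complex.I * u : ℂ) ∈ Complex.slitPlane := by
  left
  simp

theorem one_add_I_mul_ne_zero (u : ℝ) : (1 + Complex.I * u : ℂ) ≠ 0 :=
  Complex.slitPlane_ne_zero (one_add_I_mul_mem_slitPlane u)

theorem norm_one_add_I_mul (u : ℝ) : ‖(1 + Complex.I * u : ℂ)‖ = √(1 + u ^ 2) := by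
  rw [Complex.norm_def, Complex.normSq_apply]
  congr 1
  simp [sq]

theorem exp_logChar (u : ℝ) :
    Complex.exp (logChar u) = Complex.exp (Complex.I * u) / (1 + Complex.I * u) := by
  rw [logChar, Complex.exp_sub, Complex.exp_log (one_add_I_mul_ne_zero u)]

theorem logChar_zero : logChar 0 = 0 := by
  simp [logChar]

theorem re_logChar (u : ℝ) : (logChar u).re = -(Real.log (1 + u ^ 2) / 2) := by
  rw [logChar, Complex.sub_re, Complex.log_re, norm_one_add_I_mul, Real.log_sqrt (by positivity)]
  simp

theorem hasDerivAt_logChar (u : ℝ) :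
    HasDerivAt logChar (Complex.I - Complex.I / (1 + Complex.I * u)) u := by
  have hlin : HasDerivAt (fun x : ℝ => Complex.I * (x : ℂ)) Complex.I u := by
    simpa using Complex.ofRealCLM.hasDerivAt.const_mul Complex.I
  exact hlin.sub ((hlin.const_add 1).clog_real (one_add_I_mul_mem_slitPlane u))

theorem hasDerivAt_logChar_add_sq_half (u : ℝ) :
    HasDerivAt (fun x : ℝ => logChar x + (x : ℂ) ^ 2 / 2)
      (Complex.I * u ^ 2 / (1 + Complex.I * u)) u := by
  have hsq : HasDerivAt (fun x : ℝ => (x : ℂ) ^ 2 / 2) (u : ℂ) u := by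
    simpa using (Complex.ofRealCLM.hasDerivAt.pow 2).div_const 2
  refine ((hasDerivAt_logChar u).add hsq).congr_deriv ?_
  have := one_add_I_mul_ne_zero u
  field_simp
  linear_combination (u : ℂ) * Complex.I_sq

theorem norm_logChar_add_sq_half_le (u : ℝ) : ‖logChar u + (u : ℂ) ^ 2 / 2‖ ≤ |u| ^ 3 := by
  have hderiv : ∀ x ∈ Set.Icc (-|u|) |u|,
      ‖(Complex.I * x ^ 2 / (1 + Complex.I * x) : ℂ)‖ ≤ |u| ^ 2 := by
    intro x hx
    have hone : 1 ≤ √(1 + x ^ 2) := Real.one_le_sqrt.2 (by linarith [sq_nonneg x])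
    rw [norm_div, norm_one_add_I_mul, norm_mul, Complex.norm_I, one_mul, norm_pow,
      Complex.norm_real, Real.norm_eq_abs]
    calc |x| ^ 2 / √(1 + x ^ 2) ≤ |x| ^ 2 := div_le_self (by positivity) hone
      _ ≤ |u| ^ 2 := pow_le_pow_left₀ (abs_nonneg x) (abs_le.2 hx) 2
  have hmean := Convex.norm_image_sub_le_of_norm_hasDerivWithin_le
    (fun x _ => (hasDerivAt_logChar_add_sq_half x).hasDerivWithinAt) hderiv (convex_Icc _ _)
    (x := 0) (y := u) (by simp) ⟨neg_abs_le u, le_abs_self u⟩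
  simpa [logChar_zero, pow_succ] using hmean

theorem norm_exp_sub_exp_le (a b : ℂ) {M : ℝ} (ha : a.re ≤ M) (hb : b.re ≤ M) :
    ‖Complex.exp a - Complex.exp b‖ ≤ Real.exp M * ‖a - b‖ := by
  refine Convex.norm_image_sub_le_of_norm_hasDerivWithin_le (f := Complex.exp)
    (f' := Complex.exp) (s := {c : ℂ | c.re ≤ M})
    (fun x _ => (Complex.hasDerivAt_exp x).hasDerivWithinAt) (fun x hx => ?_)
    (convex_halfSpace_re_le M) hb ha
  rw [Complex.norm_exp]
  exact Real.exp_le_exp.2 hx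

theorem div_mul_log_one_add_le {s M : ℝ} (hs : 0 ≤ s) (hsM : s ≤ M) (hM : 0 < M) :
    s / M * Real.log (1 + M) ≤ Real.log (1 + s) := by
  rw [← Real.log_rpow (by linarith)]
  apply Real.log_le_log (by positivity)
  have hbernoulli := rpow_one_add_le_one_add_mul_self (s := M) (p := s / M) (by linarith)
    (by positivity) (by rwa [div_le_one hM])
  rwa [div_mul_cancel₀ _ hM.ne'] at hbernoulli

theorem abs_pow_three_le {σ : ℝ} (hσ : 0 < σ) (x : ℝ) :
    |x| ^ 3 ≤ 6 * σ ^ 3 * (Real.exp (x / σ) + Real.exp (-(x / σ))) := by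
  have hpow := Real.pow_div_factorial_le_exp (|x| / σ) (by positivity) 3
  have hexp : Real.exp (|x| / σ) ≤ Real.exp (x / σ) + Real.exp (-(x / σ)) := by
    rcases abs_cases x with ⟨h, _⟩ | ⟨h, _⟩ <;> rw [h]
    · linarith [Real.exp_pos (-(x / σ))]
    · rw [neg_div]; linarith [Real.exp_pos (x / σ)]
  rw [div_pow, div_div, div_le_iff₀ (by positivity), Nat.factorial] at hpow
  calc |x| ^ 3 ≤ 6 * σ ^ 3 * Real.exp (|x| / σ) := by
        norm_num [Nat.factorial] at hpow; linarith
    _ ≤ _ := by gcongr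

/-- Log-convexity of `Γ` between `m - p` and `m`, evaluated at `m - p + 1`. -/
theorem rpow_mul_Gamma_sub_le {m p : ℝ} (hp : 1 ≤ p) (hpm : p < m) :
    (m - p) ^ p * Real.Gamma (m - p) ≤ Real.Gamma m := by
  have hx : 0 < m - p := by linarith
  have hp0 : 0 < p := by linarith
  have hG : 0 < Real.Gamma (m - p) := Real.Gamma_pos_of_pos hx
  have hm : 0 < m := by linarith
  have hconv := Real.convexOn_log_Gamma.2 (Set.mem_Ioi.2 hx) (Set.mem_Ioi.2 hm)
    (sub_nonneg.2 (inv_le_one_of_one_le₀ hp)) (by positivity) (sub_add_cancel 1 p⁻¹)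
  have hpoint : (1 - p⁻¹) * (m - p) + p⁻¹ * m = m - p + 1 := by
    field_simp
    ring
  simp only [smul_eq_mul, hpoint, Function.comp_apply, Real.Gamma_add_one hx.ne',
    Real.log_mul hx.ne' hG.ne'] at hconv
  rw [← Real.log_le_log_iff (by positivity) (Real.Gamma_pos_of_pos hm),
    Real.log_mul (by positivity) hG.ne', Real.log_rpow hx]
  have hscale := mul_le_mul_of_nonneg_left hconv hp0.le
  field_simp at hscale
  linarith

theorem rpow_neg_mul_Gamma_ratio_le_two {κ p : ℝ} (hκ : 0 < κ) (hp : 1 ≤ p)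
    (hpκ : p ^ 2 * κ ≤ 1 / 2) :
    κ ^ (-p) * (Real.Gamma (1 / κ - p) / Real.Gamma (1 / κ)) ≤ 2 := by
  have hpκ' : p * κ ≤ 1 / 2 := by nlinarith
  have hpm : p < 1 / κ := by rw [lt_div_iff₀ hκ]; linarith
  have hmp : 0 < 1 / κ - p := by linarith
  have hG : 0 < Real.Gamma (1 / κ) := Real.Gamma_pos_of_pos (by positivity)
  have hbernoulli : 1 / 2 ≤ κ ^ p * (1 / κ - p) ^ p := by
    rw [← Real.mul_rpow hκ.le hmp.le, show κ * (1 / κ - p) = 1 + -(p * κ) by field_simp; ring]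
    linarith [one_add_mul_self_le_rpow_one_add (s := -(p * κ)) (by linarith) hp]
  rw [Real.rpow_neg hκ.le, inv_mul_le_iff₀ (by positivity), div_le_iff₀ hG]
  have hGp : 0 < Real.Gamma (1 / κ - p) := Real.Gamma_pos_of_pos hmp
  calc Real.Gamma (1 / κ - p)
      ≤ 2 * (κ ^ p * (1 / κ - p) ^ p) * Real.Gamma (1 / κ - p) :=
        le_mul_of_one_le_left hGp.le (by linarith)
    _ = κ ^ p * 2 * ((1 / κ - p) ^ p * Real.Gamma (1 / κ - p)) := by ring
    _ ≤ _ := by gcongr; exact rpow_mul_Gamma_sub_le hp hpm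

end Scalar

section QuadraticSum

variable {E ι : Type*} [Fintype ι] [AddCommGroup E] [Module ℝ E]

/-- Half the sum of the squares of a family of linear functionals. -/
def halfSq (u : ι → E →ₗ[ℝ] ℝ) (t : E) : ℝ := 1 / 2 * ∑ j, u j t ^ 2

theorem halfSq_nonneg (u : ι → E →ₗ[ℝ] ℝ) (t : E) : 0 ≤ halfSq u t := by
  unfold halfSq; positivity

theorem halfSq_smul (u : ι → E →ₗ[ℝ] ℝ) (c : ℝ) (t : E) :
    halfSq u (c • t) = c ^ 2 * halfSq u t := by
  simp only [halfSq, map_smul, smul_eq_mul, mul_pow, ← Finset.mul_sum]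
  ring

/-- The product of the characteristic functions of centered exponential variables. -/
def charProd (u : ι → E →ₗ[ℝ] ℝ) (t : E) : ℂ :=
  ∏ j, Complex.exp (Complex.I * u j t) / (1 + Complex.I * u j t)

theorem charProd_eq_exp (u : ι → E →ₗ[ℝ] ℝ) (t : E) :
    charProd u t = Complex.exp (∑ j, logChar (u j t)) := by
  rw [Complex.exp_sum]
  exact Finset.prod_congr rfl fun j _ => (exp_logChar _).symm

theorem re_sum_logChar_le (u : ι → E →ₗ[ℝ] ℝ) {κ : ℝ} (hκ : 0 < κ)
    (hu : ∀ j t, u j t ^ 2 ≤ κ * halfSq u t) (t : E) :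
    (∑ j, logChar (u j t)).re ≤ -(1 / κ) * Real.log (1 + κ * halfSq u t) := by
  rw [Complex.re_sum]
  simp only [re_logChar, Finset.sum_neg_distrib]
  rcases (halfSq_nonneg u t).eq_or_lt with h0 | h0
  · rw [← h0]
    simp only [mul_zero, add_zero, Real.log_one, Left.neg_nonpos_iff]
    exact Finset.sum_nonneg fun j _ =>
      div_nonneg (Real.log_nonneg (by nlinarith [sq_nonneg (u j t)])) zero_le_two
  · rw [neg_mul, neg_le_neg_iff]
    have hM : 0 < κ * halfSq u t := by positivity
    calc 1 / κ * Real.log (1 + κ * halfSq u t)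
        = ∑ j, u j t ^ 2 / (κ * halfSq u t) * Real.log (1 + κ * halfSq u t) / 2 := by
          rw [← Finset.sum_div, ← Finset.sum_mul, ← Finset.sum_div]
          have : ∑ j, u j t ^ 2 = 2 * halfSq u t := by unfold halfSq; ring
          rw [this]
          field_simp
      _ ≤ _ := by
          gcongr with j
          exact div_mul_log_one_add_le (sq_nonneg _) (hu j t) hM

theorem norm_charProd_le (u : ι → E →ₗ[ℝ] ℝ) {κ : ℝ} (hκ : 0 < κ)
    (hu : ∀ j t, u j t ^ 2 ≤ κ * halfSq u t) (t : E) :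
    ‖charProd u t‖ ≤ (1 + κ * halfSq u t) ^ (-(1 / κ)) := by
  have h1 : 0 < 1 + κ * halfSq u t := by have := halfSq_nonneg u t; positivity
  rw [charProd_eq_exp, Complex.norm_exp, Real.rpow_def_of_pos h1, mul_comm]
  exact Real.exp_le_exp.2 (re_sum_logChar_le u hκ hu t)

theorem norm_charProd_sub_exp_le (u : ι → E →ₗ[ℝ] ℝ) {κ : ℝ} (hκ : 0 < κ)
    (hu : ∀ j t, u j t ^ 2 ≤ κ * halfSq u t) (t : E) :
    ‖charProd u t - (Real.exp (-halfSq u t) : ℝ)‖ ≤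
      ∑ j, |u j t| ^ 3 * (1 + κ * halfSq u t) ^ (-(1 / κ)) := by
  have h1 : 0 < 1 + κ * halfSq u t := by have := halfSq_nonneg u t; positivity
  rw [charProd_eq_exp, Complex.ofReal_exp, Real.rpow_def_of_pos h1, ← Finset.sum_mul, mul_comm,
    mul_comm (Real.log _)]
  have hq : ((-halfSq u t : ℝ) : ℂ).re ≤ -(1 / κ) * Real.log (1 + κ * halfSq u t) := by
    rw [Complex.ofReal_re, neg_mul, neg_le_neg_iff, one_div, inv_mul_le_iff₀ hκ]
    have := Real.log_le_sub_one_of_pos h1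
    linarith
  refine (norm_exp_sub_exp_le _ _ (re_sum_logChar_le u hκ hu t) hq).trans ?_
  gcongr
  have : ∑ j, logChar (u j t) - ((-halfSq u t : ℝ) : ℂ) =
      ∑ j, (logChar (u j t) + (u j t : ℂ) ^ 2 / 2) := by
    rw [Finset.sum_add_distrib, ← Finset.sum_div, halfSq]
    push_cast
    ring
  rw [this]
  exact (norm_sum_le _ _).trans (Finset.sum_le_sum fun j _ => norm_logChar_add_sq_half_le _)

end QuadraticSum

section GammaMixture

theorem lintegral_rpow_mul_exp_neg_mul_Ioi {a r : ℝ} (ha : 0 < a) (hr : 0 < r) :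
    ∫⁻ s in Set.Ioi (0 : ℝ), ENNReal.ofReal (s ^ (a - 1) * Real.exp (-(r * s))) =
      ENNReal.ofReal (r ^ (-a) * Real.Gamma a) := by
  have hint : IntegrableOn (fun s : ℝ => s ^ (a - 1) * Real.exp (-(r * s))) (Set.Ioi 0) := by
    simpa using integrableOn_rpow_mul_exp_neg_mul_rpow (p := 1) (s := a - 1) (b := r)
      (by linarith) one_pos hr
  rw [Real.rpow_neg hr.le, ← Real.inv_rpow hr.le, ← one_div,
    ← Real.integral_rpow_mul_exp_neg_mul_Ioi ha hr, ofReal_integral_eq_lintegral_ofReal hint]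
  filter_upwards [ae_restrict_mem measurableSet_Ioi] with s hs
  have : 0 < s := hs
  positivity

theorem ofReal_mul_one_add_rpow_neg_eq_lintegral {y x m : ℝ} (hy : 0 ≤ y) (hx : 0 ≤ x)
    (hm : 0 < m) :
    ENNReal.ofReal (y * (1 + x) ^ (-m)) = ENNReal.ofReal (Real.Gamma m)⁻¹ *
      ∫⁻ s in Set.Ioi (0 : ℝ), ENNReal.ofReal (s ^ (m - 1) * Real.exp (-s)) *
        ENNReal.ofReal (y * Real.exp (-(s * x))) := by
  have : 0 < Real.Gamma m := Real.Gamma_pos_of_pos hm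
  have hsplit : ∀ s ∈ Set.Ioi (0 : ℝ), ENNReal.ofReal (s ^ (m - 1) * Real.exp (-s)) *
      ENNReal.ofReal (y * Real.exp (-(s * x))) =
        ENNReal.ofReal y * ENNReal.ofReal (s ^ (m - 1) * Real.exp (-((1 + x) * s))) := by
    intro s hs
    have : 0 < s := hs
    rw [← ENNReal.ofReal_mul (by positivity), ← ENNReal.ofReal_mul hy,
      show -((1 + x) * s) = -s + -(s * x) by ring, Real.exp_add]
    congr 1
    ring
  rw [setLIntegral_congr_fun measurableSet_Ioi hsplit, lintegral_const_mul _ (by fun_prop),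
    lintegral_rpow_mul_exp_neg_mul_Ioi hm (by positivity), ← ENNReal.ofReal_mul hy,
    ← ENNReal.ofReal_mul (by positivity)]
  congr 1
  field_simp

end GammaMixture

section GaussianMoments

variable {E ι : Type*} [Fintype ι] [NormedAddCommGroup E] [NormedSpace ℝ E]
  [FiniteDimensional ℝ E]

theorem continuous_halfSq (u : ι → E →ₗ[ℝ] ℝ) : Continuous (halfSq u) := by
  have : ∀ j, Continuous (u j) := fun j => (u j).continuous_of_finiteDimensional
  unfold halfSq
  fun_prop

theorem exists_forall_sub_halfSq_eq (u : ι → E →ₗ[ℝ] ℝ) (hpos : ∀ t, t ≠ 0 → 0 < halfSq u t)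
    (l : E →ₗ[ℝ] ℝ) :
    ∃ s, l s = 2 * halfSq u s ∧ ∀ t, l t - halfSq u t = halfSq u s - halfSq u (t - s) := by
  let b : E →ₗ[ℝ] Module.Dual ℝ E := ∑ j, (u j).smulRight (u j)
  have hb : ∀ s t, b s t = ∑ j, u j s * u j t := by simp [b]
  have hself : ∀ s, b s s = 2 * halfSq u s := by
    intro s
    simp only [hb, halfSq, ← sq]
    ring
  have hinj : Function.Injective b := by
    rw [injective_iff_map_eq_zero]
    intro s hs
    by_contra hne
    have := hself s
    rw [hs, LinearMap.zero_apply] at this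
    linarith [hpos s hne]
  obtain ⟨s, rfl⟩ := (LinearMap.injective_iff_surjective_of_finrank_eq_finrank
    Subspace.dual_finrank_eq.symm).1 hinj l
  refine ⟨s, hself s, fun t => ?_⟩
  simp only [hb, halfSq, map_sub, Finset.mul_sum, ← Finset.sum_sub_distrib]
  exact Finset.sum_congr rfl fun j _ => by ring

variable [MeasurableSpace E] [BorelSpace E] (μ : Measure E) [μ.IsAddHaarMeasure]

theorem lintegral_comp_smul_of_pos {f : E → ENNReal} (hf : Measurable f) {c : ℝ} (hc : 0 < c) :
    ∫⁻ t, f (c • t) ∂μ = ENNReal.ofReal (c ^ (-(Module.finrank ℝ E : ℝ))) * ∫⁻ t, f t ∂μ := by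
  rw [← lintegral_map hf (by fun_prop), Measure.map_addHaar_smul μ hc.ne', lintegral_smul_measure,
    smul_eq_mul, abs_of_pos (by positivity), Real.rpow_neg hc.le, Real.rpow_natCast]

theorem lintegral_mul_exp_neg_mul_halfSq (u : ι → E →ₗ[ℝ] ℝ) {h : E → ℝ} (hm : Measurable h)
    {r : ℕ} (hh : ∀ (c : ℝ) t, 0 < c → h (c • t) = c ^ r * h t) {s : ℝ} (hs : 0 < s) :
    ∫⁻ t, ENNReal.ofReal (h t * Real.exp (-(s * halfSq u t))) ∂μ =
      ENNReal.ofReal (s ^ (-((Module.finrank ℝ E + r : ℝ) / 2))) *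
        ∫⁻ t, ENNReal.ofReal (h t * Real.exp (-halfSq u t)) ∂μ := by
  have hsqrt : 0 < √s := Real.sqrt_pos.2 hs
  have hQ := (continuous_halfSq u).measurable
  have hscale : ∀ t, ENNReal.ofReal (h t * Real.exp (-(s * halfSq u t))) =
      ENNReal.ofReal (√s ^ (-(r : ℝ))) *
        ENNReal.ofReal (h (√s • t) * Real.exp (-halfSq u (√s • t))) := by
    intro t
    rw [← ENNReal.ofReal_mul (by positivity), hh _ _ hsqrt, halfSq_smul, Real.sq_sqrt hs.le,
      Real.rpow_neg hsqrt.le, Real.rpow_natCast]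
    congr 1
    field_simp
  simp_rw [hscale]
  rw [lintegral_const_mul _ (by fun_prop),
    lintegral_comp_smul_of_pos μ (f := fun t => ENNReal.ofReal (h t * Real.exp (-halfSq u t)))
      (by fun_prop) hsqrt, ← mul_assoc, ← ENNReal.ofReal_mul (by positivity),
    ← Real.rpow_add hsqrt, Real.sqrt_eq_rpow, ← Real.rpow_mul hs.le]
  congr 3
  ring

/-- `(1 + κ q)^{-m}` is a mixture of the Gaussians `exp (-s κ q)`, with `s` following a Gamma law
of parameter `m`. -/
theorem lintegral_mul_one_add_halfSq_rpow_neg (u : ι → E →ₗ[ℝ] ℝ) {h : E → ℝ} (hm : Measurable h)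
    (h0 : ∀ t, 0 ≤ h t) {r : ℕ} (hh : ∀ (c : ℝ) t, 0 < c → h (c • t) = c ^ r * h t)
    {κ m p : ℝ} (hκ : 0 < κ) (hp : p = (Module.finrank ℝ E + r : ℝ) / 2) (hpm : p < m) :
    ∫⁻ t, ENNReal.ofReal (h t * (1 + κ * halfSq u t) ^ (-m)) ∂μ =
      ENNReal.ofReal (κ ^ (-p) * (Real.Gamma (m - p) / Real.Gamma m)) *
        ∫⁻ t, ENNReal.ofReal (h t * Real.exp (-halfSq u t)) ∂μ := by
  have hm0 : 0 < m := lt_of_le_of_lt (by rw [hp]; positivity) hpm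
  have : 0 < Real.Gamma (m - p) := Real.Gamma_pos_of_pos (sub_pos.2 hpm)
  have hQ := (continuous_halfSq u).measurable
  set I := ∫⁻ t, ENNReal.ofReal (h t * Real.exp (-halfSq u t)) ∂μ with hI
  have hinner : ∀ s ∈ Set.Ioi (0 : ℝ),
      ∫⁻ t, ENNReal.ofReal (s ^ (m - 1) * Real.exp (-s)) *
        ENNReal.ofReal (h t * Real.exp (-(s * (κ * halfSq u t)))) ∂μ =
      ENNReal.ofReal (κ ^ (-p)) * I *
        ENNReal.ofReal (s ^ (m - p - 1) * Real.exp (-(1 * s))) := by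
    intro s (hs : 0 < s)
    simp only [← mul_assoc s κ]
    rw [lintegral_const_mul _ (by fun_prop),
      lintegral_mul_exp_neg_mul_halfSq μ u hm hh (mul_pos hs hκ), ← hp, ← hI,
      Real.mul_rpow hs.le hκ.le, ENNReal.ofReal_mul (p := s ^ (-p)) (by positivity),
      show m - p - 1 = m - 1 + -p by ring, Real.rpow_add hs, one_mul,
      mul_right_comm _ (s ^ (-p)), ENNReal.ofReal_mul (q := s ^ (-p)) (by positivity)]
    ring
  calc ∫⁻ t, ENNReal.ofReal (h t * (1 + κ * halfSq u t) ^ (-m)) ∂μ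
      = ENNReal.ofReal (Real.Gamma m)⁻¹ * ∫⁻ t, (∫⁻ s in Set.Ioi (0 : ℝ),
          ENNReal.ofReal (s ^ (m - 1) * Real.exp (-s)) *
            ENNReal.ofReal (h t * Real.exp (-(s * (κ * halfSq u t))))) ∂μ := by
        rw [← lintegral_const_mul' _ _ ENNReal.ofReal_ne_top]
        exact lintegral_congr fun t => ofReal_mul_one_add_rpow_neg_eq_lintegral (h0 t)
          (mul_nonneg hκ.le (halfSq_nonneg u t)) hm0
    _ = ENNReal.ofReal (Real.Gamma m)⁻¹ * ∫⁻ s in Set.Ioi (0 : ℝ),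
          ENNReal.ofReal (κ ^ (-p)) * I *
            ENNReal.ofReal (s ^ (m - p - 1) * Real.exp (-(1 * s))) := by
        rw [lintegral_lintegral_swap (by unfold Function.uncurry; fun_prop),
          setLIntegral_congr_fun measurableSet_Ioi hinner]
    _ = _ := by
        rw [lintegral_const_mul _ (by fun_prop),
          lintegral_rpow_mul_exp_neg_mul_Ioi (sub_pos.2 hpm) one_pos, Real.one_rpow, one_mul,
          div_eq_mul_inv, ENNReal.ofReal_mul (by positivity), ENNReal.ofReal_mul (by positivity)]
        ring

theorem lintegral_exp_sub_halfSq_le (u : ι → E →ₗ[ℝ] ℝ) (hpos : ∀ t, t ≠ 0 → 0 < halfSq u t)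
    (l : E →ₗ[ℝ] ℝ) {c : ℝ} (hc : 0 ≤ c) (hl : ∀ t, l t ^ 2 ≤ c * halfSq u t) :
    ∫⁻ t, ENNReal.ofReal (Real.exp (l t - halfSq u t)) ∂μ ≤
      ENNReal.ofReal (Real.exp (c / 4)) * ∫⁻ t, ENNReal.ofReal (Real.exp (-halfSq u t)) ∂μ := by
  obtain ⟨s, hls, hsquare⟩ := exists_forall_sub_halfSq_eq u hpos l
  have hs : halfSq u s ≤ c / 4 := by
    have hle := hl s
    rw [hls] at hle
    rcases (halfSq_nonneg u s).eq_or_lt with h0 | h0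
    · linarith
    · nlinarith
  simp_rw [hsquare, sub_eq_add_neg (halfSq u s), Real.exp_add,
    ENNReal.ofReal_mul (Real.exp_pos _).le]
  rw [lintegral_const_mul' _ _ ENNReal.ofReal_ne_top,
    lintegral_sub_right_eq_self (fun t => ENNReal.ofReal (Real.exp (-halfSq u t))) s]
  gcongr

theorem lintegral_exp_smul_sub_halfSq_le (u : ι → E →ₗ[ℝ] ℝ)
    (hpos : ∀ t, t ≠ 0 → 0 < halfSq u t) (l : E →ₗ[ℝ] ℝ) {κ c : ℝ}
    (hl : ∀ t, l t ^ 2 ≤ κ * halfSq u t) (hc : c ^ 2 * κ = 1) :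
    ∫⁻ t, ENNReal.ofReal (Real.exp ((c • l) t - halfSq u t)) ∂μ ≤
      ENNReal.ofReal (Real.exp (1 / 4)) * ∫⁻ t, ENNReal.ofReal (Real.exp (-halfSq u t)) ∂μ := by
  refine lintegral_exp_sub_halfSq_le μ u hpos (c • l) zero_le_one fun t => ?_
  calc (c • l) t ^ 2 = c ^ 2 * l t ^ 2 := by rw [LinearMap.smul_apply, smul_eq_mul, mul_pow]
    _ ≤ c ^ 2 * (κ * halfSq u t) := mul_le_mul_of_nonneg_left (hl t) (sq_nonneg c)
    _ = 1 * halfSq u t := by rw [← mul_assoc, hc]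

theorem lintegral_abs_pow_three_mul_exp_neg_halfSq_le (u : ι → E →ₗ[ℝ] ℝ)
    (hpos : ∀ t, t ≠ 0 → 0 < halfSq u t) (l : E →ₗ[ℝ] ℝ) {κ : ℝ} (hκ : 0 < κ)
    (hl : ∀ t, l t ^ 2 ≤ κ * halfSq u t) :
    ∫⁻ t, ENNReal.ofReal (|l t| ^ 3 * Real.exp (-halfSq u t)) ∂μ ≤
      ENNReal.ofReal (12 * Real.exp (1 / 4) * √κ ^ 3) *
        ∫⁻ t, ENNReal.ofReal (Real.exp (-halfSq u t)) ∂μ := by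
  have hσ : 0 < √κ := Real.sqrt_pos.2 hκ
  have hmeas : Measurable l := l.continuous_of_finiteDimensional.measurable
  have hQ := (continuous_halfSq u).measurable
  have hscale : (√κ)⁻¹ ^ 2 * κ = 1 := by
    rw [inv_pow, Real.sq_sqrt hκ.le, inv_mul_cancel₀ hκ.ne']
  calc ∫⁻ t, ENNReal.ofReal (|l t| ^ 3 * Real.exp (-halfSq u t)) ∂μ
      ≤ ∫⁻ t, ENNReal.ofReal (6 * √κ ^ 3) *
          (ENNReal.ofReal (Real.exp (((√κ)⁻¹ • l) t - halfSq u t)) +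
            ENNReal.ofReal (Real.exp ((-(√κ)⁻¹ • l) t - halfSq u t))) ∂μ := by
        refine lintegral_mono fun t => ?_
        rw [← ENNReal.ofReal_add (by positivity) (by positivity),
          ← ENNReal.ofReal_mul (by positivity)]
        refine ENNReal.ofReal_le_ofReal ?_
        simp only [LinearMap.smul_apply, smul_eq_mul, neg_mul, sub_eq_add_neg, Real.exp_add,
          ← add_mul, ← div_eq_inv_mul, ← mul_assoc]
        gcongr
        exact abs_pow_three_le hσ (l t)
    _ ≤ ENNReal.ofReal (6 * √κ ^ 3) *
          (ENNReal.ofReal (Real.exp (1 / 4)) * ∫⁻ t, ENNReal.ofReal (Real.exp (-halfSq u t)) ∂μ +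
            ENNReal.ofReal (Real.exp (1 / 4)) *
              ∫⁻ t, ENNReal.ofReal (Real.exp (-halfSq u t)) ∂μ) := by
        rw [lintegral_const_mul' _ _ ENNReal.ofReal_ne_top,
          lintegral_add_left (by simp only [LinearMap.smul_apply]; fun_prop)]
        gcongr
        · exact lintegral_exp_smul_sub_halfSq_le μ u hpos l hl hscale
        · exact lintegral_exp_smul_sub_halfSq_le μ u hpos l hl (by rwa [neg_sq])
    _ = _ := by
        rw [show 12 * Real.exp (1 / 4) * √κ ^ 3 = (6 * √κ ^ 3) * (2 * Real.exp (1 / 4)) by ring,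
          ENNReal.ofReal_mul (p := 6 * √κ ^ 3) (by positivity),
          ENNReal.ofReal_mul (p := 2) (by positivity), ENNReal.ofReal_ofNat]
        ring

end GaussianMoments

section CharProdIntegral

variable {E ι : Type*} [Fintype ι] [NormedAddCommGroup E] [NormedSpace ℝ E]
  [FiniteDimensional ℝ E]

theorem continuous_charProd (u : ι → E →ₗ[ℝ] ℝ) : Continuous (charProd u) := by
  have : ∀ j, Continuous (u j) := fun j => (u j).continuous_of_finiteDimensional
  exact continuous_finsetProd _ fun j _ =>
    Continuous.div (by fun_prop) (by fun_prop) fun t => one_add_I_mul_ne_zero _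

variable [MeasurableSpace E] [BorelSpace E] (μ : Measure E) [μ.IsAddHaarMeasure]

theorem integrable_charProd (u : ι → E →ₗ[ℝ] ℝ) {κ : ℝ} (hκ : 0 < κ)
    (hu : ∀ j t, u j t ^ 2 ≤ κ * halfSq u t)
    (hint : Integrable (fun t => Real.exp (-halfSq u t)) μ)
    (hκd : (Module.finrank ℝ E : ℝ) / 2 * κ < 1) : Integrable (charProd u) μ := by
  refine ⟨(continuous_charProd u).aestronglyMeasurable, ?_⟩
  calc ∫⁻ t, ‖charProd u t‖ₑ ∂μ
      ≤ ∫⁻ t, ENNReal.ofReal (1 * (1 + κ * halfSq u t) ^ (-(1 / κ))) ∂μ := by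
        refine lintegral_mono fun t => ?_
        rw [← ofReal_norm, one_mul]
        exact ENNReal.ofReal_le_ofReal (norm_charProd_le u hκ hu t)
    _ < ⊤ := by
        rw [lintegral_mul_one_add_halfSq_rpow_neg μ u measurable_const (fun _ => zero_le_one)
          (r := 0) (by simp) hκ rfl (by rw [lt_div_iff₀ hκ]; simpa using hκd)]
        simp only [one_mul]
        exact ENNReal.mul_lt_top ENNReal.ofReal_lt_top hint.lintegral_lt_top

theorem lintegral_abs_pow_three_mul_one_add_halfSq_rpow_le (u : ι → E →ₗ[ℝ] ℝ)
    (hpos : ∀ t, t ≠ 0 → 0 < halfSq u t) (l : E →ₗ[ℝ] ℝ) {κ p : ℝ} (hκ : 0 < κ)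
    (hl : ∀ t, l t ^ 2 ≤ κ * halfSq u t) (hp : p = (Module.finrank ℝ E + 3 : ℝ) / 2)
    (hpκ : p ^ 2 * κ ≤ 1 / 2) :
    ∫⁻ t, ENNReal.ofReal (|l t| ^ 3 * (1 + κ * halfSq u t) ^ (-(1 / κ))) ∂μ ≤
      ENNReal.ofReal (24 * Real.exp (1 / 4) * √κ ^ 3) *
        ∫⁻ t, ENNReal.ofReal (Real.exp (-halfSq u t)) ∂μ := by
  have hp1 : 1 ≤ p := by rw [hp]; linarith [(Module.finrank ℝ E).cast_nonneg (α := ℝ)]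
  have hmeas : Measurable l := l.continuous_of_finiteDimensional.measurable
  rw [lintegral_mul_one_add_halfSq_rpow_neg μ u (by fun_prop) (fun t => by positivity) (r := 3)
    (fun c t hc => by rw [map_smul, smul_eq_mul, abs_mul, abs_of_pos hc, mul_pow]) (p := p) hκ
    (by rw [hp]; norm_num) (by rw [lt_div_iff₀ hκ]; nlinarith)]
  calc _ ≤ ENNReal.ofReal 2 * (ENNReal.ofReal (12 * Real.exp (1 / 4) * √κ ^ 3) *
        ∫⁻ t, ENNReal.ofReal (Real.exp (-halfSq u t)) ∂μ) := by
        gcongr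
        · exact rpow_neg_mul_Gamma_ratio_le_two hκ hp1 hpκ
        · exact lintegral_abs_pow_three_mul_exp_neg_halfSq_le μ u hpos l hκ hl
    _ = _ := by
        rw [← mul_assoc, ← ENNReal.ofReal_mul zero_le_two]
        congr 2
        ring

theorem norm_integral_charProd_sub_le (u : ι → E →ₗ[ℝ] ℝ) (hpos : ∀ t, t ≠ 0 → 0 < halfSq u t)
    {κ p : ℝ} (hκ : 0 < κ) (hu : ∀ j t, u j t ^ 2 ≤ κ * halfSq u t)
    (hint : Integrable (fun t => Real.exp (-halfSq u t)) μ)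
    (hp : p = (Module.finrank ℝ E + 3 : ℝ) / 2) (hpκ : p ^ 2 * κ ≤ 1 / 2) :
    ‖∫ t, charProd u t ∂μ - (∫ t, Real.exp (-halfSq u t) ∂μ : ℝ)‖ ≤
      Fintype.card ι * (24 * Real.exp (1 / 4) * √κ ^ 3) * ∫ t, Real.exp (-halfSq u t) ∂μ := by
  have hd := (Module.finrank ℝ E).cast_nonneg (α := ℝ)
  have hmeas : ∀ j, Measurable (u j) := fun j =>
    (u j).continuous_of_finiteDimensional.measurable
  have hQ := (continuous_halfSq u).measurable
  have hchar : Integrable (charProd u) μ :=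
    integrable_charProd μ u hκ hu hint (by rw [hp] at hpκ; nlinarith)
  have hgauss : Integrable (fun t => ((Real.exp (-halfSq u t) : ℝ) : ℂ)) μ := hint.ofReal
  rw [← integral_complex_ofReal, ← integral_sub hchar hgauss]
  refine (norm_integral_le_lintegral_norm _).trans (ENNReal.toReal_le_of_le_ofReal
    (mul_nonneg (by positivity) (integral_nonneg fun t => (Real.exp_pos _).le)) ?_)
  rw [ENNReal.ofReal_mul (by positivity), ofReal_integral_eq_lintegral_ofReal hint
    (Eventually.of_forall fun t => (Real.exp_pos _).le)]
  calc ∫⁻ t, ENNReal.ofReal ‖charProd u t - (Real.exp (-halfSq u t) : ℝ)‖ ∂μ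
      ≤ ∫⁻ t, ∑ j, ENNReal.ofReal (|u j t| ^ 3 * (1 + κ * halfSq u t) ^ (-(1 / κ))) ∂μ := by
        refine lintegral_mono fun t => ?_
        have : 0 ≤ 1 + κ * halfSq u t := by have := halfSq_nonneg u t; positivity
        rw [← ENNReal.ofReal_sum_of_nonneg fun j _ => by positivity]
        exact ENNReal.ofReal_le_ofReal (norm_charProd_sub_exp_le u hκ hu t)
    _ = ∑ j, ∫⁻ t, ENNReal.ofReal (|u j t| ^ 3 * (1 + κ * halfSq u t) ^ (-(1 / κ))) ∂μ :=
        lintegral_finsetSum _ fun j _ => by have := hmeas j; fun_prop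
    _ ≤ ∑ _j : ι, ENNReal.ofReal (24 * Real.exp (1 / 4) * √κ ^ 3) *
          ∫⁻ t, ENNReal.ofReal (Real.exp (-halfSq u t)) ∂μ :=
        Finset.sum_le_sum fun j _ =>
          lintegral_abs_pow_three_mul_one_add_halfSq_rpow_le μ u hpos (u j) hκ (hu j) hp hpκ
    _ = _ := by
        rw [Finset.sum_const, Finset.card_univ, nsmul_eq_mul,
          ENNReal.ofReal_mul (p := (Fintype.card ι : ℝ)) (by positivity), ENNReal.ofReal_natCast]
        ring

end CharProdIntegral

section ChangeOfVariables

variable {U V : Type*} [NormedAddCommGroup U] [InnerProductSpace ℝ U] [FiniteDimensional ℝ U]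
  [NormedAddCommGroup V] [InnerProductSpace ℝ V]

theorem normDet_pos_of_injective {f : U →ₗ[ℝ] V} (hf : Function.Injective f) : 0 < f.normDet :=
  f.normDet_nonneg.lt_of_ne fun h =>
    LinearMap.normDet_eq_zero_iff_ker_ne_bot.1 h.symm (LinearMap.ker_eq_bot.2 hf)

theorem normDet_ofInjective {f : U →ₗ[ℝ] V} (hf : Function.Injective f) :
    (LinearEquiv.ofInjective f hf : U →ₗ[ℝ] LinearMap.range f).normDet = f.normDet :=
  LinearMap.normDet_codRestrict (f := f) fun c => LinearMap.mem_range_self f c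

variable [MeasurableSpace U] [BorelSpace U]

theorem map_linearEquiv_volume [MeasurableSpace V] [BorelSpace V] [FiniteDimensional ℝ V]
    (f : U ≃ₗ[ℝ] V) :
    (volume : Measure U).map f =
      ENNReal.ofReal ((f : U →ₗ[ℝ] V).normDet)⁻¹ • (volume : Measure V) := by
  have hpos : 0 < (f : U →ₗ[ℝ] V).normDet := normDet_pos_of_injective f.injective
  have hmeas : Measurable f := (f : U →ₗ[ℝ] V).continuous_of_finiteDimensional.measurable
  ext s hs
  have himage := LinearMap.euclideanHausdorffMeasure_image_eq_normDet_mul_volume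
    (f : U →ₗ[ℝ] V) (f ⁻¹' s)
  rw [f.finrank_eq, InnerProductSpace.euclideanHausdorffMeasure_eq_volume,
    LinearEquiv.coe_coe, Set.image_preimage_eq _ f.surjective] at himage
  rw [Measure.map_apply hmeas hs, Measure.smul_apply, smul_eq_mul, himage, ← mul_assoc,
    ← ENNReal.ofReal_mul (by positivity), inv_mul_cancel₀ hpos.ne', ENNReal.ofReal_one, one_mul]

theorem integral_exp_neg_half_sq_norm {f : U →ₗ[ℝ] V} (hf : Function.Injective f) :
    ∫ x, Real.exp (-(1 / 2 * ‖f x‖ ^ 2)) =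
      (2 * Real.pi) ^ ((Module.finrank ℝ U : ℝ) / 2) / f.normDet := by
  borelize V
  let e := LinearEquiv.ofInjective f hf
  have hmeas : Measurable e := e.toContinuousLinearEquiv.continuous.measurable
  let g : LinearMap.range f → ℝ := fun y => Real.exp (-(1 / 2) * ‖y‖ ^ 2)
  have hg : AEStronglyMeasurable g ((volume : Measure U).map e) :=
    (show Continuous g by fun_prop).aestronglyMeasurable
  calc ∫ x, Real.exp (-(1 / 2 * ‖f x‖ ^ 2)) = ∫ x, g (e x) := by
        simp only [g, neg_mul]
        rfl
    _ = f.normDet⁻¹ * ∫ y, g y := by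
        rw [← integral_map hmeas.aemeasurable hg, map_linearEquiv_volume e,
          normDet_ofInjective hf, integral_smul_measure,
          ENNReal.toReal_ofReal (inv_nonneg.2 f.normDet_nonneg), smul_eq_mul]
    _ = _ := by
        rw [GaussianFourier.integral_rexp_neg_mul_sq_norm (by norm_num), ← e.finrank_eq,
          div_eq_inv_mul _ f.normDet, show Real.pi / (1 / 2) = 2 * Real.pi by ring]

theorem integrable_exp_neg_half_sq_norm {f : U →ₗ[ℝ] V} (hf : Function.Injective f) :
    Integrable fun x => Real.exp (-(1 / 2 * ‖f x‖ ^ 2)) := by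
  have := normDet_pos_of_injective hf
  refine Integrable.of_integral_ne_zero ?_
  rw [integral_exp_neg_half_sq_norm hf]
  positivity

variable [MeasurableSpace V] [BorelSpace V] [FiniteDimensional ℝ V]

/-- The coordinates `(s, v) ↦ w s + v` on `V` given by an injective linear map `w` into `V` and the
orthogonal complement of its range. -/
def orthogonalCoordinates {w : U →ₗ[ℝ] V} (hw : Function.Injective w) :
    U × (LinearMap.range w)ᗮ ≃ᵐ V :=
  (MeasurableEquiv.prodCongr
    (LinearEquiv.ofInjective w hw).toContinuousLinearEquiv.toHomeomorph.toMeasurableEquiv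
    (MeasurableEquiv.refl _)).trans ((LinearMap.range w).measurableEquivProd (0 : V)).symm

theorem orthogonalCoordinates_apply {w : U →ₗ[ℝ] V} (hw : Function.Injective w)
    (x : U × (LinearMap.range w)ᗮ) : orthogonalCoordinates hw x = w x.1 + x.2 :=
  ((LinearMap.range w).measurableEquivProd_symm_apply 0
    (LinearEquiv.ofInjective w hw x.1, x.2)).trans (add_zero _)

theorem map_orthogonalCoordinates {w : U →ₗ[ℝ] V} (hw : Function.Injective w) :
    (volume : Measure (U × (LinearMap.range w)ᗮ)).map (orthogonalCoordinates hw) =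
      ENNReal.ofReal (w.normDet)⁻¹ • (volume : Measure V) := by
  have hsum := (LinearMap.range w).measurePreserving_measurableEquivProd (0 : V)
  rw [InnerProductSpace.euclideanHausdorffMeasure_eq_volume] at hsum
  have hrange : MeasurePreserving (LinearEquiv.ofInjective w hw)
      (volume : Measure U) (ENNReal.ofReal (w.normDet)⁻¹ • volume) := by
    refine ⟨(LinearEquiv.ofInjective w hw).toContinuousLinearEquiv.continuous.measurable, ?_⟩
    rw [map_linearEquiv_volume, normDet_ofInjective hw]
  have hprod := hrange.prod (MeasurePreserving.id (volume : Measure (LinearMap.range w)ᗮ))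
  rw [Measure.prod_smul_left] at hprod
  exact ((hsum.symm.smul_measure (ENNReal.ofReal (w.normDet)⁻¹)).comp hprod).map_eq

variable {F : Type*} [NormedAddCommGroup F]

theorem integrable_comp_orthogonalCoordinates {w : U →ₗ[ℝ] V} (hw : Function.Injective w)
    {H : V → F} (hH : Integrable H) :
    Integrable (fun x : U × (LinearMap.range w)ᗮ => H (w x.1 + x.2)) (volume.prod volume) := by
  have hmap : Integrable H ((volume : Measure (U × (LinearMap.range w)ᗮ)).map
      (orthogonalCoordinates hw)) := by
    rw [map_orthogonalCoordinates hw]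
    exact hH.smul_measure ENNReal.ofReal_ne_top
  refine (hmap.comp_measurable (orthogonalCoordinates hw).measurable).congr
    (Eventually.of_forall fun x => ?_)
  simp only [Function.comp, orthogonalCoordinates_apply]

theorem integral_integral_orthogonalCoordinates [NormedSpace ℝ F] {w : U →ₗ[ℝ] V}
    (hw : Function.Injective w) {H : V → F} (hH : Integrable H) :
    ∫ s : U, ∫ v : (LinearMap.range w)ᗮ, H (w s + v) = (w.normDet)⁻¹ • ∫ x, H x := by
  have hmap := integral_map_equiv (μ := (volume : Measure (U × (LinearMap.range w)ᗮ)))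
    (orthogonalCoordinates hw) H
  rw [map_orthogonalCoordinates hw, integral_smul_measure,
    ENNReal.toReal_ofReal (inv_nonneg.2 w.normDet_nonneg)] at hmap
  rw [← integral_prod _ (integrable_comp_orthogonalCoordinates hw hH), hmap]
  simp only [orthogonalCoordinates_apply]
  rfl

end ChangeOfVariables

section RightInverse

variable {R ι : Type*} [Fintype R] [DecidableEq R] [Fintype ι]

theorem normDet_toEuclideanLin_sq (W : Matrix ι R ℝ) :
    (Matrix.toEuclideanLin W).normDet ^ 2 = (Wᵀ * W).det := by
  have hgram := LinearMap.normDet_sq_eq_det_gram (Matrix.toEuclideanLin W)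
    (EuclideanSpace.basisFun R ℝ)
  rw [RCLike.ofReal_real_eq_id, id] at hgram
  rw [hgram]
  congr 1
  ext r s
  simp [Matrix.gram, Matrix.mul_apply, PiLp.inner_apply, Matrix.mulVec_single, mul_comm]

theorem det_mul_transpose_nonneg (A : Matrix R ι ℝ) : 0 ≤ (A * Aᵀ).det := by
  simpa using (Matrix.posSemidef_self_mul_conjTranspose A).det_nonneg

/-- The right inverse of `A` with values orthogonal to the kernel of `A`. -/
def rightInv (A : Matrix R ι ℝ) : EuclideanSpace ℝ R →ₗ[ℝ] EuclideanSpace ℝ ι :=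
  Matrix.toEuclideanLin (Aᵀ * (A * Aᵀ)⁻¹)

variable {A : Matrix R ι ℝ}

theorem sum_mul_rightInv (hA : (A * Aᵀ).det ≠ 0) (s : EuclideanSpace ℝ R) (r : R) :
    ∑ j, A r j * rightInv A s j = s r := by
  change (A *ᵥ ((Aᵀ * (A * Aᵀ)⁻¹) *ᵥ s.ofLp)) r = s r
  rw [Matrix.mulVec_mulVec, ← Matrix.mul_assoc, Matrix.mul_nonsing_inv _ (Ne.isUnit hA),
    Matrix.one_mulVec]

theorem rightInv_injective (hA : (A * Aᵀ).det ≠ 0) : Function.Injective (rightInv A) := by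
  intro s t h
  ext r
  rw [← sum_mul_rightInv hA s r, h, sum_mul_rightInv hA]

theorem inner_rightInv (A : Matrix R ι ℝ) (s : EuclideanSpace ℝ R) (v : EuclideanSpace ℝ ι) :
    inner ℝ (rightInv A s) v = ((A * Aᵀ)⁻¹ *ᵥ s.ofLp) ⬝ᵥ (A *ᵥ v.ofLp) := by
  rw [EuclideanSpace.inner_eq_star_dotProduct, star_trivial]
  change v.ofLp ⬝ᵥ ((Aᵀ * (A * Aᵀ)⁻¹) *ᵥ s.ofLp) = _
  rw [← Matrix.mulVec_mulVec, Matrix.dotProduct_mulVec, Matrix.vecMul_transpose, dotProduct_comm]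

theorem mem_range_rightInv_orthogonal (hA : (A * Aᵀ).det ≠ 0) (v : EuclideanSpace ℝ ι) :
    v ∈ (LinearMap.range (rightInv A))ᗮ ↔ ∀ r, ∑ j, A r j * v j = 0 := by
  have hmulVec : (∀ r, ∑ j, A r j * v j = 0) ↔ A *ᵥ v.ofLp = 0 := by
    rw [funext_iff]
    rfl
  rw [hmulVec, Submodule.mem_orthogonal]
  constructor
  · intro h
    have hself := h _ (LinearMap.mem_range_self (rightInv A)
      (WithLp.toLp 2 ((A * Aᵀ) *ᵥ (A *ᵥ v.ofLp))))
    rw [inner_rightInv, Matrix.mulVec_mulVec, Matrix.nonsing_inv_mul _ (Ne.isUnit hA),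
      Matrix.one_mulVec] at hself
    exact dotProduct_self_eq_zero.1 hself
  · rintro h _ ⟨s, rfl⟩
    rw [inner_rightInv, h, dotProduct_zero]

theorem normDet_rightInv (hA : (A * Aᵀ).det ≠ 0) : (rightInv A).normDet = (√(A * Aᵀ).det)⁻¹ := by
  have hsq := normDet_toEuclideanLin_sq (Aᵀ * (A * Aᵀ)⁻¹)
  have hsymm : (A * Aᵀ)ᵀ = A * Aᵀ := by rw [Matrix.transpose_mul, Matrix.transpose_transpose]
  rw [Matrix.transpose_mul, Matrix.transpose_transpose, Matrix.transpose_nonsing_inv, hsymm,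
    Matrix.mul_assoc, ← Matrix.mul_assoc A, Matrix.mul_nonsing_inv _ (Ne.isUnit hA),
    Matrix.mul_one, Matrix.det_nonsing_inv, Ring.inverse_eq_inv'] at hsq
  rw [← Real.sqrt_inv, ← hsq, Real.sqrt_sq (LinearMap.normDet_nonneg _), rightInv]

theorem finrank_range_rightInv_orthogonal (hA : (A * Aᵀ).det ≠ 0) :
    Module.finrank ℝ (LinearMap.range (rightInv A))ᗮ = Fintype.card ι - Fintype.card R := by
  have hsum := (LinearMap.range (rightInv A)).finrank_add_finrank_orthogonal
  rw [LinearMap.finrank_range_of_inj (rightInv_injective hA), finrank_euclideanSpace,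
    finrank_euclideanSpace] at hsum
  omega

end RightInverse

section ExponentialDensity

open ProbabilityTheory (exponentialPDFReal exponentialPDFReal_nonneg)

theorem exponentialPDFReal_of_nonneg (r : ℝ) {x : ℝ} (hx : 0 ≤ x) :
    exponentialPDFReal r x = r * Real.exp (-(r * x)) := by
  simp [exponentialPDFReal, ProbabilityTheory.gammaPDFReal, hx]

theorem exponentialPDFReal_of_neg (r : ℝ) {x : ℝ} (hx : x < 0) : exponentialPDFReal r x = 0 := by
  simp [exponentialPDFReal, ProbabilityTheory.gammaPDFReal, hx.not_ge]

theorem exponentialPDFReal_le {r : ℝ} (hr : 0 < r) (x : ℝ) : exponentialPDFReal r x ≤ r := by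
  rcases le_or_gt 0 x with hx | hx
  · rw [exponentialPDFReal_of_nonneg r hx]
    exact mul_le_of_le_one_right hr.le (Real.exp_le_one_iff.2 (neg_nonpos.2 (by positivity)))
  · rw [exponentialPDFReal_of_neg r hx]
    exact hr.le

theorem continuousAt_exponentialPDFReal (r : ℝ) {x : ℝ} (hx : x ≠ 0) :
    ContinuousAt (exponentialPDFReal r) x := by
  rcases hx.lt_or_gt with h | h
  · refine (continuousAt_const (y := (0 : ℝ))).congr ?_
    filter_upwards [Iio_mem_nhds h] with y hy
    rw [exponentialPDFReal_of_neg r hy]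
  · refine (show ContinuousAt (fun x => r * Real.exp (-(r * x))) x by fun_prop).congr ?_
    filter_upwards [Ioi_mem_nhds h] with y hy
    rw [exponentialPDFReal_of_nonneg r (le_of_lt hy)]

theorem exp_mul_exponentialPDFReal_eq_indicator (r c : ℝ) :
    (fun x : ℝ => Complex.exp (-(Complex.I * (c * x : ℝ))) * (exponentialPDFReal r x : ℂ)) =
      (Set.Ici 0).indicator fun x : ℝ => (r : ℂ) * Complex.exp (-(r + Complex.I * c) * x) := by
  ext x
  rcases le_or_gt 0 x with hx | hx
  · rw [Set.indicator_of_mem (Set.mem_Ici.2 hx), exponentialPDFReal_of_nonneg r hx]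
    push_cast
    rw [mul_left_comm, ← Complex.exp_add]
    ring_nf
  · rw [Set.indicator_of_notMem (by simpa using hx), exponentialPDFReal_of_neg r hx,
      Complex.ofReal_zero, mul_zero]

theorem integrable_exp_mul_exponentialPDFReal {r : ℝ} (hr : 0 < r) (c : ℝ) :
    Integrable fun x : ℝ =>
      Complex.exp (-(Complex.I * (c * x : ℝ))) * (exponentialPDFReal r x : ℂ) := by
  rw [exp_mul_exponentialPDFReal_eq_indicator, integrable_indicator_iff measurableSet_Ici,
    integrableOn_Ici_iff_integrableOn_Ioi]
  exact (integrableOn_exp_mul_complex_Ioi (by simpa using hr) 0).const_mul _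

theorem integral_exp_mul_exponentialPDFReal {r : ℝ} (hr : 0 < r) (c : ℝ) :
    ∫ x : ℝ, Complex.exp (-(Complex.I * (c * x : ℝ))) * (exponentialPDFReal r x : ℂ) =
      1 / (1 + Complex.I * (r⁻¹ * c : ℝ)) := by
  have hr' : (r : ℂ) ≠ 0 := by exact_mod_cast hr.ne'
  have := one_add_I_mul_ne_zero (r⁻¹ * c)
  have hrate : (r : ℂ) + Complex.I * c = r * (1 + Complex.I * (r⁻¹ * c : ℝ)) := by
    push_cast
    field_simp
  rw [exp_mul_exponentialPDFReal_eq_indicator, integral_indicator measurableSet_Ici,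
    integral_Ici_eq_integral_Ioi, integral_const_mul,
    integral_exp_mul_complex_Ioi (by simpa using hr), hrate, Complex.ofReal_zero, mul_zero,
    Complex.exp_zero]
  field_simp

variable {ι : Type*} [Fintype ι]

/-- The joint density of independent exponential variables of means `z j`. -/
def exponentialDensity (z x : EuclideanSpace ℝ ι) : ℝ := ∏ j, exponentialPDFReal (z j)⁻¹ (x j)

theorem measurable_exponentialDensity (z : EuclideanSpace ℝ ι) :
    Measurable (exponentialDensity z) := by
  unfold exponentialDensity
  fun_prop

theorem exponentialDensity_nonneg {z : EuclideanSpace ℝ ι} (hz : ∀ j, 0 < z j)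
    (x : EuclideanSpace ℝ ι) : 0 ≤ exponentialDensity z x :=
  Finset.prod_nonneg fun j _ => exponentialPDFReal_nonneg (inv_pos.2 (hz j)) _

theorem exponentialDensity_le {z : EuclideanSpace ℝ ι} (hz : ∀ j, 0 < z j)
    (x : EuclideanSpace ℝ ι) : exponentialDensity z x ≤ ∏ j, (z j)⁻¹ :=
  Finset.prod_le_prod (fun j _ => exponentialPDFReal_nonneg (inv_pos.2 (hz j)) _) fun j _ =>
    exponentialPDFReal_le (inv_pos.2 (hz j)) _

theorem exponentialDensity_of_nonneg (z : EuclideanSpace ℝ ι) {x : EuclideanSpace ℝ ι}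
    (hx : ∀ j, 0 ≤ x j) :
    exponentialDensity z x = (∏ j, (z j)⁻¹) * Real.exp (-∑ j, x j / z j) := by
  rw [exponentialDensity, ← Finset.sum_neg_distrib, Real.exp_sum, ← Finset.prod_mul_distrib]
  exact Finset.prod_congr rfl fun j _ => by
    rw [exponentialPDFReal_of_nonneg _ (hx j), div_eq_inv_mul]

theorem exponentialDensity_eq_zero (z : EuclideanSpace ℝ ι) {x : EuclideanSpace ℝ ι}
    (hx : ¬ ∀ j, 0 ≤ x j) : exponentialDensity z x = 0 := by
  push Not at hx
  obtain ⟨j, hj⟩ := hx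
  exact Finset.prod_eq_zero (Finset.mem_univ j) (exponentialPDFReal_of_neg _ hj)

theorem continuousAt_exponentialDensity (z : EuclideanSpace ℝ ι) {x : EuclideanSpace ℝ ι}
    (hx : ∀ j, x j ≠ 0) : ContinuousAt (exponentialDensity z) x :=
  tendsto_finsetProd _ fun j _ =>
    (continuousAt_exponentialPDFReal _ (hx j)).comp (f := fun x : EuclideanSpace ℝ ι => x j)
      (by fun_prop)

theorem exp_mul_exponentialDensity_eq_prod (z : EuclideanSpace ℝ ι) (c : ι → ℝ)
    (x : EuclideanSpace ℝ ι) :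
    Complex.exp (-(Complex.I * (∑ j, c j * x j : ℝ))) * (exponentialDensity z x : ℂ) =
      ∏ j, Complex.exp (-(Complex.I * (c j * x j : ℝ))) *
        (exponentialPDFReal (z j)⁻¹ (x j) : ℂ) := by
  rw [Finset.prod_mul_distrib, ← Complex.exp_sum, exponentialDensity, Complex.ofReal_prod,
    Finset.sum_neg_distrib, ← Finset.mul_sum, Complex.ofReal_sum]

theorem integrable_exp_mul_exponentialDensity {z : EuclideanSpace ℝ ι} (hz : ∀ j, 0 < z j)
    (c : ι → ℝ) :
    Integrable fun x : EuclideanSpace ℝ ι =>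
      Complex.exp (-(Complex.I * (∑ j, c j * x j : ℝ))) * (exponentialDensity z x : ℂ) := by
  simp_rw [exp_mul_exponentialDensity_eq_prod]
  exact ((PiLp.volume_preserving_ofLp ι).integrable_comp_emb
    (MeasurableEquiv.toLp 2 (ι → ℝ)).symm.measurableEmbedding).2
    (Integrable.fintype_prod (f := fun j (y : ℝ) =>
      Complex.exp (-(Complex.I * (c j * y : ℝ))) * (exponentialPDFReal (z j)⁻¹ y : ℂ))
      fun j => integrable_exp_mul_exponentialPDFReal (inv_pos.2 (hz j)) (c j))

theorem integral_exp_mul_exponentialDensity {z : EuclideanSpace ℝ ι} (hz : ∀ j, 0 < z j)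
    (c : ι → ℝ) :
    ∫ x : EuclideanSpace ℝ ι,
      Complex.exp (-(Complex.I * (∑ j, c j * x j : ℝ))) * (exponentialDensity z x : ℂ) =
      ∏ j, 1 / (1 + Complex.I * (z j * c j : ℝ)) := by
  let F : ι → ℝ → ℂ := fun j y =>
    Complex.exp (-(Complex.I * (c j * y : ℝ))) * (exponentialPDFReal (z j)⁻¹ y : ℂ)
  simp_rw [exp_mul_exponentialDensity_eq_prod]
  rw [(PiLp.volume_preserving_ofLp ι).integral_comp
    (MeasurableEquiv.toLp 2 (ι → ℝ)).symm.measurableEmbedding (fun y => ∏ j, F j (y j)),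
    integral_fintype_prod_volume_eq_prod F]
  refine Finset.prod_congr rfl fun j _ => ?_
  simpa only [inv_inv] using integral_exp_mul_exponentialPDFReal (inv_pos.2 (hz j)) (c j)

end ExponentialDensity

section FirstOrderCondition

variable {R ι : Type*} [Fintype ι] {A : Matrix R ι ℝ} {b : R → ℝ} {x y z : EuclideanSpace ℝ ι}

theorem hasDerivAt_entropy_add_smul (hz : ∀ j, 0 < z j) (v : EuclideanSpace ℝ ι) :
    HasDerivAt (fun ε : ℝ => entropy (z + ε • v)) (∑ j, v j / z j) 0 := by
  unfold entropy
  refine HasDerivAt.const_add _ (HasDerivAt.fun_sum fun j _ => ?_)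
  have hcoord : HasDerivAt (fun ε : ℝ => (z + ε • v) j) (v j) 0 := by
    simpa using ((hasDerivAt_id (0 : ℝ)).mul_const (v j)).const_add (z j)
  simpa using hcoord.log (by simpa using (hz j).ne')

theorem IsAnalyticCenter.sum_div_eq_zero (h : IsAnalyticCenter (polyhedron A b) z)
    {v : EuclideanSpace ℝ ι} (hv : ∀ r, ∑ j, A r j * v j = 0) : ∑ j, v j / z j = 0 := by
  obtain ⟨hP, hz, hmax⟩ := h
  have hpos : ∀ᶠ ε : ℝ in 𝓝 0, ∀ j, 0 < (z + ε • v) j := by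
    rw [eventually_all]
    intro j
    have hcont : ContinuousAt (fun ε : ℝ => (z + ε • v) j) 0 := by
      simp only [PiLp.add_apply, PiLp.smul_apply]; fun_prop
    exact hcont.eventually_const_lt (by simpa using hz j)
  have hloc : IsLocalMax (fun ε : ℝ => entropy (z + ε • v)) 0 := by
    filter_upwards [hpos] with ε hε
    simp only [zero_smul, add_zero]
    refine hmax _ ⟨fun r => ?_, fun j => (hε j).le⟩ hε
    simp only [PiLp.add_apply, PiLp.smul_apply, smul_eq_mul, mul_add, Finset.sum_add_distrib,
      mul_left_comm _ ε, ← Finset.mul_sum]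
    rw [hv, mul_zero, add_zero, hP.1]
  exact hloc.hasDerivAt_eq_zero (hasDerivAt_entropy_add_smul hz v)

theorem IsAnalyticCenter.sum_div_eq_sum_div (h : IsAnalyticCenter (polyhedron A b) z)
    (hxy : ∀ r, ∑ j, A r j * x j = ∑ j, A r j * y j) : ∑ j, x j / z j = ∑ j, y j / z j := by
  have hsub := h.sum_div_eq_zero (v := x - y) fun r => by
    simp only [PiLp.sub_apply, mul_sub, Finset.sum_sub_distrib, hxy, sub_self]
  simpa only [PiLp.sub_apply, sub_div, Finset.sum_sub_distrib, sub_eq_zero] using hsub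

theorem IsAnalyticCenter.exponentialDensity_eq (h : IsAnalyticCenter (polyhedron A b) z)
    (hx : x ∈ polyhedron A b) : exponentialDensity z x = Real.exp (-entropy z) := by
  have hsum : ∑ j, x j / z j = Fintype.card ι := by
    rw [h.sum_div_eq_sum_div fun r => (hx.1 r).trans (h.1.1 r).symm]
    simp [div_self (h.2.1 _).ne']
  have hlog : ∏ j, (z j)⁻¹ = Real.exp (-∑ j, Real.log (z j)) := by
    rw [← Finset.sum_neg_distrib, Real.exp_sum]
    exact Finset.prod_congr rfl fun j _ => by rw [Real.exp_neg, Real.exp_log (h.2.1 j)]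
  rw [exponentialDensity_of_nonneg z hx.2, hsum, hlog, ← Real.exp_add, entropy, ← neg_add_rev]

end FirstOrderCondition

section ColumnForm

variable {R ι : Type*} [Fintype R]

/-- The linear functional `ξ ↦ 2π ζ_j ⟨a_j, ξ⟩`; the factor `2π` comes from the normalization of
the Fourier transform. -/
def columnForm (A : Matrix R ι ℝ) (z : EuclideanSpace ℝ ι) (j : ι) :
    EuclideanSpace ℝ R →ₗ[ℝ] ℝ where
  toFun ξ := 2 * Real.pi * z j * ∑ r, A r j * ξ r
  map_add' ξ η := by simp [mul_add, Finset.sum_add_distrib]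
  map_smul' c ξ := by
    simp only [PiLp.smul_apply, smul_eq_mul, RingHom.id_apply, mul_left_comm _ c, ← Finset.mul_sum]

theorem columnForm_apply (A : Matrix R ι ℝ) (z : EuclideanSpace ℝ ι) (j : ι)
    (ξ : EuclideanSpace ℝ R) : columnForm A z j ξ = 2 * Real.pi * z j * ∑ r, A r j * ξ r := rfl

theorem sum_mul_sum_mul_eq_inner [Fintype ι] {A : Matrix R ι ℝ} {x : EuclideanSpace ℝ ι}
    {s : EuclideanSpace ℝ R} (hx : ∀ r, ∑ j, A r j * x j = s r) (ξ : EuclideanSpace ℝ R) :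
    ∑ j, (∑ r, A r j * ξ r) * x j = inner ℝ s ξ := by
  simp only [PiLp.inner_apply, RCLike.inner_apply, conj_trivial, ← hx, Finset.sum_mul,
    Finset.mul_sum]
  rw [Finset.sum_comm]
  exact Finset.sum_congr rfl fun r _ => Finset.sum_congr rfl fun j _ => by ring

end ColumnForm

section Slice

variable {R ι : Type*} [Fintype R] [DecidableEq R] [Fintype ι]

/-- The integral of the exponential density over the fibre `{x : A x = s}`. -/
def sliceDensity (A : Matrix R ι ℝ) (z : EuclideanSpace ℝ ι) (s : EuclideanSpace ℝ R) : ℂ :=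
  ∫ v : (LinearMap.range (rightInv A))ᗮ, (exponentialDensity z (rightInv A s + v) : ℂ)

variable {A : Matrix R ι ℝ} {z : EuclideanSpace ℝ ι}

theorem integrable_sliceDensity (hA : (A * Aᵀ).det ≠ 0) (hz : ∀ j, 0 < z j) :
    Integrable (sliceDensity A z) := by
  have hint : Integrable fun x => (exponentialDensity z x : ℂ) := by
    simpa using integrable_exp_mul_exponentialDensity hz 0
  exact (integrable_comp_orthogonalCoordinates (rightInv_injective hA) hint).integral_prod_left

theorem sum_mul_rightInv_add (hA : (A * Aᵀ).det ≠ 0) (s : EuclideanSpace ℝ R)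
    (v : (LinearMap.range (rightInv A))ᗮ) (r : R) :
    ∑ j, A r j * (rightInv A s + (v : EuclideanSpace ℝ ι)) j = s r := by
  simp only [PiLp.add_apply, mul_add, Finset.sum_add_distrib]
  rw [sum_mul_rightInv hA, (mem_range_rightInv_orthogonal hA _).1 v.2 r, add_zero]

theorem sub_rightInv_mem_orthogonal (hA : (A * Aᵀ).det ≠ 0) {x : EuclideanSpace ℝ ι}
    {s : EuclideanSpace ℝ R} (hx : ∀ r, ∑ j, A r j * x j = s r) :
    x - rightInv A s ∈ (LinearMap.range (rightInv A))ᗮ := by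
  rw [mem_range_rightInv_orthogonal hA]
  intro r
  simp only [PiLp.sub_apply, mul_sub, Finset.sum_sub_distrib]
  rw [hx, sum_mul_rightInv hA, sub_self]

theorem fourier_sliceDensity (hA : (A * Aᵀ).det ≠ 0) (hz : ∀ j, 0 < z j)
    (ξ : EuclideanSpace ℝ R) :
    FourierTransform.fourier (sliceDensity A z) ξ =
      (√(A * Aᵀ).det : ℂ) * ∏ j, 1 / (1 + Complex.I * columnForm A z j ξ) := by
  let c : ι → ℝ := fun j => 2 * Real.pi * ∑ r, A r j * ξ r
  let H : EuclideanSpace ℝ ι → ℂ := fun x =>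
    Complex.exp (-(Complex.I * (∑ j, c j * x j : ℝ))) * (exponentialDensity z x : ℂ)
  have hfibre : ∀ s, Complex.exp (((-2 * Real.pi * inner ℝ s ξ : ℝ) : ℂ) * Complex.I) •
      sliceDensity A z s = ∫ v : (LinearMap.range (rightInv A))ᗮ, H (rightInv A s + v) := by
    intro s
    rw [sliceDensity, smul_eq_mul, ← integral_const_mul]
    congr 1
    ext v
    simp only [H, c, mul_assoc (2 * Real.pi), ← Finset.mul_sum,
      sum_mul_sum_mul_eq_inner (sum_mul_rightInv_add hA s v)]
    push_cast
    ring_nf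
  rw [Real.fourier_eq']
  simp_rw [hfibre]
  rw [integral_integral_orthogonalCoordinates (rightInv_injective hA)
    (integrable_exp_mul_exponentialDensity hz c), integral_exp_mul_exponentialDensity hz c,
    normDet_rightInv hA, inv_inv, Complex.real_smul]
  simp only [c, columnForm_apply, mul_left_comm (z _), mul_assoc]

theorem norm_le_sum_of_nonneg {x : EuclideanSpace ℝ ι} (hx : ∀ j, 0 ≤ x j) : ‖x‖ ≤ ∑ j, x j := by
  rw [EuclideanSpace.norm_eq, Real.sqrt_le_left (Finset.sum_nonneg fun j _ => hx j)]
  simp only [Real.norm_eq_abs, sq_abs]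
  exact Finset.sum_sq_le_sq_sum_of_nonneg fun j _ => hx j

theorem norm_le_sum_mul_of_sum_div_le (hz : ∀ j, 0 < z j) {x : EuclideanSpace ℝ ι}
    (hx : ∀ j, 0 ≤ x j) {ρ : ℝ} (hρ : ∑ j, x j / z j ≤ ρ) : ‖x‖ ≤ ∑ j, z j * ρ := by
  refine (norm_le_sum_of_nonneg hx).trans (Finset.sum_le_sum fun j _ => ?_)
  rw [← div_le_iff₀' (hz j)]
  exact (Finset.single_le_sum (f := fun j => x j / z j) (fun i _ => div_nonneg (hx i) (hz i).le)
    (Finset.mem_univ j)).trans hρ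

theorem norm_le_norm_rightInv_add (s : EuclideanSpace ℝ R)
    (v : (LinearMap.range (rightInv A))ᗮ) : ‖v‖ ≤ ‖rightInv A s + (v : EuclideanSpace ℝ ι)‖ := by
  have horth : inner ℝ (rightInv A s) (v : EuclideanSpace ℝ ι) = 0 :=
    (Submodule.mem_orthogonal _ _).1 v.2 _ (LinearMap.mem_range_self _ s)
  have hpyth := norm_add_sq_eq_norm_sq_add_norm_sq_of_inner_eq_zero _ _ horth
  refine abs_le_of_sq_le_sq' ?_ (norm_nonneg _) |>.2
  rw [pow_two, pow_two, hpyth]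
  exact le_add_of_nonneg_left (mul_self_nonneg _)

theorem exponentialDensity_rightInv_add_le_indicator (hz : ∀ j, 0 < z j) (s : EuclideanSpace ℝ R)
    (v : (LinearMap.range (rightInv A))ᗮ) {ρ : ℝ}
    (hρ : ∑ j, (rightInv A s + (v : EuclideanSpace ℝ ι)) j / z j ≤ ρ) :
    exponentialDensity z (rightInv A s + v) ≤
      (Metric.closedBall (0 : (LinearMap.range (rightInv A))ᗮ) (∑ j, z j * ρ)).indicator
        (fun _ => ∏ j, (z j)⁻¹) v := by
  by_cases hx : ∀ j, 0 ≤ (rightInv A s + (v : EuclideanSpace ℝ ι)) j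
  · rw [Set.indicator_of_mem]
    · exact exponentialDensity_le hz _
    · exact mem_closedBall_zero_iff.2 ((norm_le_norm_rightInv_add s v).trans
        (norm_le_sum_mul_of_sum_div_le hz hx hρ))
  · rw [exponentialDensity_eq_zero z hx]
    exact Set.indicator_nonneg (fun _ _ => Finset.prod_nonneg fun j _ => inv_nonneg.2 (hz j).le) _

theorem ae_add_apply_ne_zero (K : Submodule ℝ (EuclideanSpace ℝ ι)) {x : EuclideanSpace ℝ ι}
    {j : ι} (h : ∃ v ∈ K, (x + v) j ≠ 0) :
    ∀ᵐ v : K, (x + (v : EuclideanSpace ℝ ι)) j ≠ 0 := by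
  let H : AffineSubspace ℝ K :=
    { carrier := {v | (x + (v : EuclideanSpace ℝ ι)) j = 0}
      smul_vsub_vadd_mem' := by
        intro c p₁ p₂ p₃ h₁ h₂ h₃
        simp only [Set.mem_ofPred_eq, PiLp.add_apply] at h₁ h₂ h₃ ⊢
        simp only [vsub_eq_sub, vadd_eq_add, Submodule.coe_add, Submodule.coe_smul,
          Submodule.coe_sub, PiLp.add_apply, PiLp.smul_apply, PiLp.sub_apply, smul_eq_mul]
        linear_combination h₃ + c * h₁ - c * h₂ }
  have hH : H ≠ ⊤ := by
    obtain ⟨v, hv, hne⟩ := h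
    intro htop
    have hmem : (⟨v, hv⟩ : K) ∈ H := htop ▸ AffineSubspace.mem_top ℝ K _
    exact hne hmem
  exact measure_eq_zero_iff_ae_notMem.1 (Measure.addHaar_affineSubspace volume H hH)

variable {b : R → ℝ}

theorem continuousAt_sliceDensity (hA : (A * Aᵀ).det ≠ 0)
    (h : IsAnalyticCenter (polyhedron A b) z) :
    ContinuousAt (sliceDensity A z) (WithLp.toLp 2 b) := by
  have hw : Continuous (rightInv A) := (rightInv A).continuous_of_finiteDimensional
  have hlin : Continuous fun s => ∑ j, rightInv A s j / z j := by fun_prop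
  have hbound : ∀ᶠ s in 𝓝 (WithLp.toLp 2 b), ∑ j, rightInv A s j / z j <
      ∑ j, rightInv A (WithLp.toLp 2 b) j / z j + 1 :=
    hlin.continuousAt.eventually_lt_const (lt_add_one _)
  set ρ := ∑ j, rightInv A (WithLp.toLp 2 b) j / z j + 1
  refine continuousAt_of_dominated (Eventually.of_forall fun s => ?_)
    (bound := (Metric.closedBall (0 : (LinearMap.range (rightInv A))ᗮ) (∑ j, z j * ρ)).indicator
      fun _ => ∏ j, (z j)⁻¹)
    (hbound.mono fun s hs => Eventually.of_forall fun v => ?_)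
    ((integrable_indicator_iff Metric.isClosed_closedBall.measurableSet).2
      (integrableOn_const (isCompact_closedBall _ _).measure_lt_top.ne)) ?_
  · exact (Complex.measurable_ofReal.comp ((measurable_exponentialDensity z).comp
      (by fun_prop))).aestronglyMeasurable
  · rw [Complex.norm_real, Real.norm_of_nonneg (exponentialDensity_nonneg h.2.1 _)]
    refine exponentialDensity_rightInv_add_le_indicator h.2.1 s v (le_trans (le_of_eq ?_) hs.le)
    exact h.sum_div_eq_sum_div fun r => by rw [sum_mul_rightInv_add hA, sum_mul_rightInv hA]
  · have hne : ∀ j, ∀ᵐ v : (LinearMap.range (rightInv A))ᗮ,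
        (rightInv A (WithLp.toLp 2 b) + (v : EuclideanSpace ℝ ι)) j ≠ 0 := fun j =>
      ae_add_apply_ne_zero _ ⟨_, sub_rightInv_mem_orthogonal hA h.1.1, by
        rw [add_sub_cancel]; exact (h.2.1 j).ne'⟩
    filter_upwards [ae_all_iff.2 hne] with v hv
    exact Complex.continuous_ofReal.continuousAt.comp
      (ContinuousAt.comp (f := fun s => rightInv A s + (v : EuclideanSpace ℝ ι))
        (continuousAt_exponentialDensity z hv) (by fun_prop))

theorem vol_polyhedron_eq_volume_fibre (hA : (A * Aᵀ).det ≠ 0) (b : R → ℝ) :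
    vol (Fintype.card ι - Fintype.card R) (polyhedron A b) =
      volume.real {v : (LinearMap.range (rightInv A))ᗮ |
        ∀ j, 0 ≤ (rightInv A (WithLp.toLp 2 b) + (v : EuclideanSpace ℝ ι)) j} := by
  let w := rightInv A (WithLp.toLp 2 b)
  let S := {v : (LinearMap.range (rightInv A))ᗮ | ∀ j, 0 ≤ (w + (v : EuclideanSpace ℝ ι)) j}
  have himage : polyhedron A b = (fun v : (LinearMap.range (rightInv A))ᗮ =>
      w + (v : EuclideanSpace ℝ ι)) '' S := by
    ext x
    constructor
    · rintro ⟨hAx, hx⟩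
      refine ⟨⟨_, sub_rightInv_mem_orthogonal (s := WithLp.toLp 2 b) hA hAx⟩, fun j => ?_,
        add_sub_cancel _ _⟩
      rw [add_sub_cancel]
      exact hx j
    · rintro ⟨v, hv, rfl⟩
      exact ⟨sum_mul_rightInv_add hA (WithLp.toLp 2 b) v, hv⟩
  have hisom : Isometry (fun v : (LinearMap.range (rightInv A))ᗮ =>
      w + (v : EuclideanSpace ℝ ι)) :=
    (IsometryEquiv.addLeft w).isometry.comp isometry_subtype_coe
  rw [vol, himage, hisom.euclideanHausdorffMeasure_image, ← finrank_range_rightInv_orthogonal hA,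
    InnerProductSpace.euclideanHausdorffMeasure_eq_volume, measureReal_def]

theorem sliceDensity_eq_exp_mul_vol (hA : (A * Aᵀ).det ≠ 0)
    (h : IsAnalyticCenter (polyhedron A b) z) :
    sliceDensity A z (WithLp.toLp 2 b) = Real.exp (-entropy z) *
      vol (Fintype.card ι - Fintype.card R) (polyhedron A b) := by
  let S := {v : (LinearMap.range (rightInv A))ᗮ |
    ∀ j, 0 ≤ (rightInv A (WithLp.toLp 2 b) + (v : EuclideanSpace ℝ ι)) j}
  have hS : MeasurableSet S := by
    simp only [S, Set.ofPred_forall]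
    exact MeasurableSet.iInter fun j =>
      (isClosed_le continuous_const (by fun_prop)).measurableSet
  have hdensity : (fun v : (LinearMap.range (rightInv A))ᗮ =>
      (exponentialDensity z (rightInv A (WithLp.toLp 2 b) + v) : ℂ)) =
      S.indicator fun _ => ((Real.exp (-entropy z) : ℝ) : ℂ) := by
    ext v
    by_cases hv : v ∈ S
    · rw [Set.indicator_of_mem hv,
        h.exponentialDensity_eq ⟨sum_mul_rightInv_add hA (WithLp.toLp 2 b) v, hv⟩]
    · rw [Set.indicator_of_notMem hv, exponentialDensity_eq_zero z hv, Complex.ofReal_zero]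
  rw [sliceDensity, hdensity, integral_indicator hS, setIntegral_const,
    vol_polyhedron_eq_volume_fibre hA, Complex.real_smul, mul_comm]

theorem exp_smul_fourier_sliceDensity (hA : (A * Aᵀ).det ≠ 0)
    (h : IsAnalyticCenter (polyhedron A b) z) (ξ : EuclideanSpace ℝ R) :
    Complex.exp (((2 * Real.pi * inner ℝ ξ (WithLp.toLp 2 b) : ℝ) : ℂ) * Complex.I) •
      FourierTransform.fourier (sliceDensity A z) ξ =
      (√(A * Aᵀ).det : ℂ) * charProd (columnForm A z) ξ := by
  have hphase : 2 * Real.pi * inner ℝ ξ (WithLp.toLp 2 b) = ∑ j, columnForm A z j ξ := by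
    rw [real_inner_comm, ← sum_mul_sum_mul_eq_inner h.1.1, Finset.mul_sum]
    exact Finset.sum_congr rfl fun j _ => by rw [columnForm_apply]; ring
  rw [fourier_sliceDensity hA h.2.1, hphase, charProd, smul_eq_mul, Complex.ofReal_sum,
    Finset.sum_mul, Complex.exp_sum, mul_left_comm, ← Finset.prod_mul_distrib]
  congr 1
  exact Finset.prod_congr rfl fun j _ => by rw [mul_one_div, mul_comm Complex.I]

theorem integrable_fourier_sliceDensity (hA : (A * Aᵀ).det ≠ 0)
    (h : IsAnalyticCenter (polyhedron A b) z) (hint : Integrable (charProd (columnForm A z))) :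
    Integrable (FourierTransform.fourier (sliceDensity A z)) := by
  have hcont : Continuous (FourierTransform.fourier (sliceDensity A z)) :=
    VectorFourier.fourierIntegral_continuous Real.continuous_fourierChar
      (by exact continuous_inner) (integrable_sliceDensity hA h.2.1)
  refine (hint.const_mul (√(A * Aᵀ).det : ℂ)).mono hcont.aestronglyMeasurable
    (Eventually.of_forall fun ξ => ?_)
  rw [← exp_smul_fourier_sliceDensity hA h, smul_eq_mul, norm_mul, Complex.norm_exp_ofReal_mul_I,
    one_mul]

theorem vol_polyhedron_eq_integral (hA : (A * Aᵀ).det ≠ 0)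
    (h : IsAnalyticCenter (polyhedron A b) z) (hint : Integrable (charProd (columnForm A z))) :
    (vol (Fintype.card ι - Fintype.card R) (polyhedron A b) : ℂ) =
      Real.exp (entropy z) * √(A * Aᵀ).det * ∫ ξ, charProd (columnForm A z) ξ := by
  have hinv := (integrable_sliceDensity hA h.2.1).fourierInv_fourier_eq
    (integrable_fourier_sliceDensity hA h hint) (continuousAt_sliceDensity hA h)
  rw [Real.fourierInv_eq'] at hinv
  simp_rw [exp_smul_fourier_sliceDensity hA h] at hinv
  rw [integral_const_mul, sliceDensity_eq_exp_mul_vol hA h] at hinv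
  rw [mul_assoc, hinv, ← mul_assoc, ← Complex.ofReal_mul, ← Real.exp_add, add_neg_cancel,
    Real.exp_zero, Complex.ofReal_one, one_mul]

end Slice

section Eigenvalue

variable {R : Type*} [Fintype R] [DecidableEq R]

theorem dotProduct_toMatrix'_mulVec (Q : QuadraticForm ℝ (R → ℝ)) (t : R → ℝ) :
    t ⬝ᵥ (Q.toMatrix' *ᵥ t) = Q t := by
  rw [← Matrix.toLinearMap₂'_apply', QuadraticForm.toMatrix', Matrix.toLinearMap₂'_toMatrix',
    QuadraticMap.associated_eq_self_apply]

theorem exists_hasEigenvalue_forall_mul_sum_sq_le [Nonempty R] (Q : QuadraticForm ℝ (R → ℝ)) :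
    ∃ l, Module.End.HasEigenvalue (Matrix.toLin' Q.toMatrix') l ∧
      ∀ t : R → ℝ, l * ∑ r, t r ^ 2 ≤ Q t := by
  set T := Matrix.toEuclideanLin Q.toMatrix'
  have hsymm : T.IsSymmetric := by
    rw [Matrix.isSymmetric_toEuclideanLin_iff, Matrix.IsHermitian,
      Matrix.conjTranspose_eq_transpose_of_trivial]
    exact QuadraticForm.isSymm_toMatrix' Q
  obtain ⟨x, hx⟩ := hsymm.hasEigenvalue_iInf_of_finiteDimensional.exists_hasEigenvector
  refine ⟨_, Module.End.hasEigenvalue_of_hasEigenvector (x := x.ofLp)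
    ⟨Module.End.mem_eigenspace_iff.2 (congrArg WithLp.ofLp hx.apply_eq_smul),
      fun h => hx.2 (WithLp.ofLp_injective 2 h)⟩, fun t => ?_⟩
  rcases eq_or_ne t 0 with rfl | ht
  · simp
  have ht' : WithLp.toLp 2 t ≠ 0 := fun h => ht (congrArg WithLp.ofLp h)
  have hbdd : BddBelow (Set.range fun x : {x : EuclideanSpace ℝ R // x ≠ 0} =>
      T.toContinuousLinearMap.rayleighQuotient x) :=
    ⟨-‖T.toContinuousLinearMap‖, Set.forall_mem_range.2 fun y =>
      neg_le_of_abs_le (T.toContinuousLinearMap.rayleighQuotient_le_norm _)⟩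
  have hle := ciInf_le hbdd ⟨WithLp.toLp 2 t, ht'⟩
  have hnorm : 0 < ‖WithLp.toLp 2 t‖ ^ 2 := by positivity
  have hinner : inner ℝ (T (WithLp.toLp 2 t)) (WithLp.toLp 2 t) = Q t := by
    rw [EuclideanSpace.inner_eq_star_dotProduct, star_trivial]
    exact dotProduct_toMatrix'_mulVec Q t
  rw [ContinuousLinearMap.rayleighQuotient, le_div_iff₀ hnorm, EuclideanSpace.real_norm_sq_eq]
    at hle
  exact hle.trans_eq hinner

theorem exists_apply_eq_mul_sum_sq_of_hasEigenvalue {Q : QuadraticForm ℝ (R → ℝ)} {μ : ℝ}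
    (h : Module.End.HasEigenvalue (Matrix.toLin' Q.toMatrix') μ) :
    ∃ t : R → ℝ, 0 < ∑ r, t r ^ 2 ∧ Q t = μ * ∑ r, t r ^ 2 := by
  obtain ⟨t, ht⟩ := h.exists_hasEigenvector
  obtain ⟨r, hr⟩ := Function.ne_iff.1 ht.2
  refine ⟨t, Finset.sum_pos' (fun r _ => sq_nonneg _) ⟨r, Finset.mem_univ _, by
    simpa using pow_pos (abs_pos.2 hr) 2⟩, ?_⟩
  have heq : Q.toMatrix' *ᵥ t = μ • t := ht.apply_eq_smul
  rw [← dotProduct_toMatrix'_mulVec, heq, dotProduct_smul, smul_eq_mul, dotProduct]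
  simp only [sq]

theorem le_of_hasEigenvalue {Q : QuadraticForm ℝ (R → ℝ)} {c μ : ℝ}
    (hc : ∀ t : R → ℝ, c * ∑ r, t r ^ 2 ≤ Q t)
    (h : Module.End.HasEigenvalue (Matrix.toLin' Q.toMatrix') μ) : c ≤ μ := by
  obtain ⟨t, hpos, heq⟩ := exists_apply_eq_mul_sum_sq_of_hasEigenvalue h
  exact le_of_mul_le_mul_right ((hc t).trans_eq heq) hpos

theorem exists_isSmallestEigenvalue [Nonempty R] (Q : QuadraticForm ℝ (R → ℝ)) :
    ∃ l, IsSmallestEigenvalue Q l ∧ ∀ t : R → ℝ, l * ∑ r, t r ^ 2 ≤ Q t := by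
  obtain ⟨l, hl, hle⟩ := exists_hasEigenvalue_forall_mul_sum_sq_le Q
  exact ⟨l, ⟨hl, fun _ hμ => le_of_hasEigenvalue hle hμ⟩, hle⟩

end Eigenvalue

section PiSums

variable {I : Type*} [Fintype I] [DecidableEq I] {α : I → Type*} [∀ i, Fintype (α i)]
  {S : Type*} [CommSemiring S]

theorem card_mul_sum_pi_comp_eval (i : I) (f : α i → S) :
    Fintype.card (α i) * ∑ J : (i : I) → α i, f (J i) =
      (∏ i, (Fintype.card (α i) : S)) * ∑ j, f j := by
  have hprod : ∀ J : (i : I) → α i,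
      ∏ i', Function.update (fun _ _ => (1 : S)) i f i' (J i') = f (J i) := fun J => by
    rw [Fintype.prod_eq_single i fun i' hi' => by rw [Function.update_of_ne hi'],
      Function.update_self]
  have hfactor := Fintype.prod_sum (Function.update (fun i (_ : α i) => (1 : S)) i f)
  simp_rw [hprod] at hfactor
  have herase : ∏ i' ∈ Finset.univ.erase i,
      ∑ j, Function.update (fun i (_ : α i) => (1 : S)) i f i' j =
        ∏ i' ∈ Finset.univ.erase i, (Fintype.card (α i') : S) :=
    Finset.prod_congr rfl fun i' hi' => by
      simp [Function.update_of_ne (Finset.ne_of_mem_erase hi')]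
  rw [← hfactor, ← Finset.mul_prod_erase _ _ (Finset.mem_univ i), herase, Function.update_self,
    ← Finset.mul_prod_erase _ (fun i => (Fintype.card (α i) : S)) (Finset.mem_univ i)]
  ring

theorem sum_pi_mul_eq_zero {i i' : I} (hne : i ≠ i') {f : α i → S} (hf : ∑ j, f j = 0)
    (f' : α i' → S) : ∑ J : (i : I) → α i, f (J i) * f' (J i') = 0 := by
  let F := Function.update (Function.update (fun i (_ : α i) => (1 : S)) i f) i' f'
  have hprod : ∀ J : (i : I) → α i, ∏ l, F l (J l) = f (J i) * f' (J i') := fun J => by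
    rw [Fintype.prod_eq_mul i i' hne fun l hl => by
      simp only [F, Function.update_of_ne hl.2, Function.update_of_ne hl.1]]
    simp only [F, Function.update_self, Function.update_of_ne hne]
  simp_rw [← hprod]
  rw [← Fintype.prod_sum]
  refine Finset.prod_eq_zero (Finset.mem_univ i) ?_
  simpa only [F, Function.update_of_ne hne, Function.update_self] using hf

theorem sum_pi_sq_const_add_sum {𝕜 : Type*} [Field 𝕜] [CharZero 𝕜] [∀ i, Nonempty (α i)] (c : 𝕜)
    {g : (i : I) → α i → 𝕜} (hg : ∀ i, ∑ j, g i j = 0) :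
    ∑ J : (i : I) → α i, (c + ∑ i, g i (J i)) ^ 2 =
      (∏ i, (Fintype.card (α i) : 𝕜)) *
        (c ^ 2 + ∑ i, (∑ j, g i j ^ 2) / Fintype.card (α i)) := by
  have hcard : ∀ i, (Fintype.card (α i) : 𝕜) ≠ 0 := fun i => Nat.cast_ne_zero.2 Fintype.card_ne_zero
  have hmean : ∀ i, ∑ J : (i : I) → α i, g i (J i) = 0 := fun i =>
    (mul_eq_zero.1 ((card_mul_sum_pi_comp_eval i (g i)).trans
      (by rw [hg, mul_zero]))).resolve_left (hcard i)
  have hsq : ∀ i, ∑ J : (i : I) → α i, g i (J i) ^ 2 =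
      (∏ i, (Fintype.card (α i) : 𝕜)) * ((∑ j, g i j ^ 2) / Fintype.card (α i)) := fun i => by
    rw [← mul_div_assoc, eq_div_iff (hcard i), mul_comm,
      card_mul_sum_pi_comp_eval i fun j => g i j ^ 2]
  have hcross : ∀ i, ∑ J : (i : I) → α i, ∑ i', g i (J i) * g i' (J i') =
      ∑ J : (i : I) → α i, g i (J i) ^ 2 := fun i => by
    rw [Finset.sum_comm, Fintype.sum_eq_single i fun i' hi' => sum_pi_mul_eq_zero hi'.symm (hg i) _]
    simp only [sq]
  calc ∑ J : (i : I) → α i, (c + ∑ i, g i (J i)) ^ 2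
      = ∑ J : (i : I) → α i, (c ^ 2 + 2 * c * ∑ i, g i (J i) +
          ∑ i, ∑ i', g i (J i) * g i' (J i')) := by
        simp only [add_sq, sq (∑ i, g i _), ← Finset.mul_sum, Finset.sum_mul_sum]
    _ = (∏ i, (Fintype.card (α i) : 𝕜)) * c ^ 2 +
          ∑ i, ∑ J : (i : I) → α i, g i (J i) ^ 2 := by
        rw [Finset.sum_add_distrib, Finset.sum_add_distrib, ← Finset.mul_sum,
          Finset.sum_comm (f := fun (J : (i : I) → α i) i => g i (J i)),
          Finset.sum_comm (f := fun (J : (i : I) → α i) i => ∑ i', g i (J i) * g i' (J i'))]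
        simp only [hcross, hmean, mul_zero, Finset.sum_const_zero, add_zero,
          Finset.sum_const, Finset.card_univ, Fintype.card_pi, nsmul_eq_mul, Nat.cast_prod]
    _ = _ := by simp only [hsq, mul_add, Finset.mul_sum]

end PiSums

section SectionMatrix

variable {ν : ℕ} {k : Fin ν → ℕ}

/-- The coordinates of `t` in direction `i`, extended by zero to the last index, for which the
system has no equation. -/
def extendZero (t : Eqn k → ℝ) (i : Fin ν) (j : Fin (k i)) : ℝ :=
  if h : (j : ℕ) + 1 < k i then t (some ⟨i, ⟨j, h⟩⟩) else 0

theorem sum_subtype_eq_sum_extendZero (t : Eqn k → ℝ) (i : Fin ν) {f : Fin (k i) → ℝ → ℝ}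
    (hf : ∀ j, f j 0 = 0) :
    ∑ j : {j : Fin (k i) // (j : ℕ) + 1 < k i}, f j.1 (t (some ⟨i, j⟩)) =
      ∑ j, f j (extendZero t i j) := by
  have hext : ∀ j : {j : Fin (k i) // (j : ℕ) + 1 < k i},
      f j.1 (t (some ⟨i, j⟩)) = f j.1 (extendZero t i j.1) := fun j => by
    rw [extendZero, dif_pos j.2]
  simp_rw [hext]
  rw [← Finset.sum_subtype (Finset.univ.filter fun j : Fin (k i) => (j : ℕ) + 1 < k i)
    (by simp) fun j => f j (extendZero t i j), Finset.sum_filter]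
  refine Finset.sum_congr rfl fun j _ => ?_
  split_ifs with h
  · rfl
  · rw [extendZero, dif_neg h, hf]

theorem sum_sectionMatrix_mul (t : Eqn k → ℝ) (J : Cell k) :
    ∑ r, sectionMatrix k r J * t r = t none + ∑ i, extendZero t i (J i) := by
  rw [Fintype.sum_option, Fintype.sum_sigma]
  congr 1
  · simp [sectionMatrix]
  · refine Finset.sum_congr rfl fun i _ => ?_
    simpa [sectionMatrix] using sum_subtype_eq_sum_extendZero t i
      (f := fun j x => (if J i = j then 1 else 0) * x) (by simp)

theorem sum_sq_eq_sum_extendZero_sq (t : Eqn k → ℝ) :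
    ∑ r, t r ^ 2 = t none ^ 2 + ∑ i, ∑ j, extendZero t i j ^ 2 := by
  rw [Fintype.sum_option, Fintype.sum_sigma]
  congr 1
  exact Finset.sum_congr rfl fun i _ =>
    sum_subtype_eq_sum_extendZero t i (f := fun _ x => x ^ 2) (by simp)

theorem extendZero_last (t : Eqn k → ℝ) {i : Fin ν} (hk : 0 < k i) :
    extendZero t i ⟨k i - 1, Nat.sub_one_lt hk.ne'⟩ = 0 :=
  dif_neg (by simp only; lia)

/-- The mean of `t` in direction `i`, the last index counting with the value zero. -/
def sectionMean (t : Eqn k → ℝ) (i : Fin ν) : ℝ := (∑ j, extendZero t i j) / k i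

/-- The deviation of `t` from its mean in direction `i`. -/
def sectionDev (t : Eqn k → ℝ) (i : Fin ν) (j : Fin (k i)) : ℝ :=
  extendZero t i j - sectionMean t i

/-- The constant term of the array `J ↦ ⟨a_J, t⟩`, in its orthogonal decomposition into a constant
and centred functions of one index each. -/
def sectionConst (t : Eqn k → ℝ) : ℝ := t none + ∑ i, sectionMean t i

/-- The mean square of the array `J ↦ ⟨a_J, t⟩`, as the sum of the mean squares of its orthogonal
components. -/
def sectionEnergy (t : Eqn k → ℝ) : ℝ :=
  sectionConst t ^ 2 + ∑ i, (∑ j, sectionDev t i j ^ 2) / k i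

theorem sum_sectionMatrix_mul_eq_const_add_sum_dev (t : Eqn k → ℝ) (J : Cell k) :
    ∑ r, sectionMatrix k r J * t r = sectionConst t + ∑ i, sectionDev t i (J i) := by
  simp only [sum_sectionMatrix_mul, sectionConst, sectionDev, Finset.sum_sub_distrib]
  ring

theorem natCast_mul_sectionMean (t : Eqn k → ℝ) {i : Fin ν} (hk : 0 < k i) :
    k i * sectionMean t i = ∑ j, extendZero t i j :=
  mul_div_cancel₀ _ (Nat.cast_ne_zero.2 hk.ne')

theorem sum_sectionDev (t : Eqn k → ℝ) {i : Fin ν} (hk : 0 < k i) : ∑ j, sectionDev t i j = 0 := by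
  simp only [sectionDev, Finset.sum_sub_distrib, Finset.sum_const, Finset.card_univ,
    Fintype.card_fin, nsmul_eq_mul, natCast_mul_sectionMean t hk, sub_self]

theorem sum_cell_sq_eq (hk : ∀ i, 0 < k i) (t : Eqn k → ℝ) :
    ∑ J : Cell k, (∑ r, sectionMatrix k r J * t r) ^ 2 =
      (∏ i, (k i : ℝ)) * sectionEnergy t := by
  have hne : ∀ i, Nonempty (Fin (k i)) := fun i => ⟨⟨0, hk i⟩⟩
  simp_rw [sum_sectionMatrix_mul_eq_const_add_sum_dev]
  rw [sum_pi_sq_const_add_sum _ fun i => sum_sectionDev t (hk i)]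
  simp only [Fintype.card_fin, sectionEnergy]

theorem sum_extendZero_sq (t : Eqn k → ℝ) {i : Fin ν} (hk : 0 < k i) :
    ∑ j, extendZero t i j ^ 2 = ∑ j, sectionDev t i j ^ 2 + k i * sectionMean t i ^ 2 := by
  have hexpand : ∀ j, extendZero t i j ^ 2 = sectionDev t i j ^ 2 +
      2 * sectionMean t i * sectionDev t i j + sectionMean t i ^ 2 := fun j => by
    rw [sectionDev]; ring
  simp only [hexpand, Finset.sum_add_distrib, ← Finset.mul_sum, sum_sectionDev t hk, mul_zero,
    add_zero, Finset.sum_const, Finset.card_univ, Fintype.card_fin, nsmul_eq_mul]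

theorem sectionMean_sq_le (t : Eqn k → ℝ) {i : Fin ν} (hk : 0 < k i) :
    sectionMean t i ^ 2 ≤ ∑ j, sectionDev t i j ^ 2 := by
  -- At the last index the deviation is `-sectionMean t i`.
  have hlast := Finset.single_le_sum (f := fun j => sectionDev t i j ^ 2)
    (fun j _ => sq_nonneg _) (Finset.mem_univ ⟨k i - 1, Nat.sub_one_lt hk.ne'⟩)
  simpa only [sectionDev, extendZero_last t hk, zero_sub, neg_sq] using hlast

theorem sq_add_sum_le {κ : Type*} [Fintype κ] (c : ℝ) (x : κ → ℝ) :
    (c + ∑ i, x i) ^ 2 ≤ (Fintype.card κ + 1) * (c ^ 2 + ∑ i, x i ^ 2) := by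
  have hCS := sq_sum_le_card_mul_sum_sq (s := Finset.univ) (f := fun o : Option κ => o.elim c x)
  simpa [Fintype.sum_option] using hCS

theorem sq_sum_sectionMatrix_mul_le (hk : ∀ i, 0 < k i) {M : ℝ} (hM₁ : 1 ≤ M)
    (hM : ∀ i, (k i : ℝ) ≤ M) (t : Eqn k → ℝ) (J : Cell k) :
    (∑ r, sectionMatrix k r J * t r) ^ 2 ≤ (ν + 1) * M * sectionEnergy t := by
  have hcomponents : sectionConst t ^ 2 + ∑ i, sectionDev t i (J i) ^ 2 ≤ M * sectionEnergy t := by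
    rw [sectionEnergy, mul_add, Finset.mul_sum]
    refine add_le_add (le_mul_of_one_le_left (sq_nonneg _) hM₁)
      (Finset.sum_le_sum fun i _ => ?_)
    have hki : (0 : ℝ) < k i := Nat.cast_pos.2 (hk i)
    calc sectionDev t i (J i) ^ 2
        ≤ ∑ j, sectionDev t i j ^ 2 :=
          Finset.single_le_sum (f := fun j => sectionDev t i j ^ 2) (fun j _ => sq_nonneg _)
            (Finset.mem_univ _)
      _ = k i * ((∑ j, sectionDev t i j ^ 2) / k i) := (mul_div_cancel₀ _ hki.ne').symm
      _ ≤ M * ((∑ j, sectionDev t i j ^ 2) / k i) := by gcongr; exact hM i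
  rw [sum_sectionMatrix_mul_eq_const_add_sum_dev]
  calc (sectionConst t + ∑ i, sectionDev t i (J i)) ^ 2
      ≤ (ν + 1) * (sectionConst t ^ 2 + ∑ i, sectionDev t i (J i) ^ 2) := by
        simpa only [Fintype.card_fin] using
          sq_add_sum_le (sectionConst t) fun i => sectionDev t i (J i)
    _ ≤ (ν + 1) * (M * sectionEnergy t) := by gcongr
    _ = (ν + 1) * M * sectionEnergy t := by ring

theorem sum_sq_le_sectionConst_sq_add (hk : ∀ i, 0 < k i) (t : Eqn k → ℝ) :
    ∑ r, t r ^ 2 ≤ (ν + 1) * sectionConst t ^ 2 +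
      ∑ i, ((ν : ℝ) + 2 + k i) * ∑ j, sectionDev t i j ^ 2 := by
  have hnone : t none ^ 2 ≤ (ν + 1) * sectionConst t ^ 2 + (ν + 1) * ∑ i, sectionMean t i ^ 2 := by
    have hCS := sq_add_sum_le (sectionConst t) fun i => -sectionMean t i
    simpa only [sectionConst, Finset.sum_neg_distrib, add_neg_cancel_right, neg_sq,
      Fintype.card_fin, mul_add] using hCS
  rw [sum_sq_eq_sum_extendZero_sq]
  refine (add_le_add_left hnone _).trans ?_
  rw [add_assoc, Finset.mul_sum, ← Finset.sum_add_distrib]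
  refine add_le_add_right (Finset.sum_le_sum fun i _ => ?_) _
  rw [sum_extendZero_sq t (hk i)]
  calc _ = ∑ j, sectionDev t i j ^ 2 + (ν + 1 + k i) * sectionMean t i ^ 2 := by ring
    _ ≤ ∑ j, sectionDev t i j ^ 2 + (ν + 1 + k i) * ∑ j, sectionDev t i j ^ 2 := by
      gcongr; exact sectionMean_sq_le t (hk i)
    _ = _ := by ring

theorem sum_sq_le_sectionEnergy (hk : ∀ i, 0 < k i) {M : ℝ} (hM₁ : 1 ≤ M)
    (hM : ∀ i, (k i : ℝ) ≤ M) (t : Eqn k → ℝ) :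
    ∑ r, t r ^ 2 ≤ (ν + 3) * M ^ 2 * sectionEnergy t := by
  refine (sum_sq_le_sectionConst_sq_add hk t).trans ?_
  rw [sectionEnergy, mul_add, Finset.mul_sum]
  refine add_le_add ?_ (Finset.sum_le_sum fun i _ => ?_)
  · gcongr
    exact (by linarith : (ν : ℝ) + 1 ≤ ν + 3).trans
      (le_mul_of_one_le_right (by positivity) (one_le_pow₀ hM₁))
  have hki : (1 : ℝ) ≤ k i := Nat.one_le_cast.2 (hk i)
  have hnonneg : 0 ≤ ∑ j, sectionDev t i j ^ 2 := Finset.sum_nonneg fun j _ => sq_nonneg _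
  rw [← mul_div_assoc, le_div_iff₀ (by positivity), mul_right_comm]
  refine mul_le_mul_of_nonneg_right ?_ hnonneg
  calc ((ν : ℝ) + 2 + k i) * k i ≤ ((ν + 2) * k i + k i) * k i := by
        gcongr; exact le_mul_of_one_le_right (by positivity) hki
    _ = (ν + 3) * (k i : ℝ) ^ 2 := by ring
    _ ≤ (ν + 3) * M ^ 2 := by gcongr; exact hM i

/-- The vector `t` for which `⟨a_J, t⟩` is minus the indicator of the last slice in the direction
`i₀`; it attains the smallest eigenvalue up to a constant factor. -/
def testVector (k : Fin ν → ℕ) (i₀ : Fin ν) : Eqn k → ℝ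
  | none => -1
  | some e => if e.1 = i₀ then 1 else 0

theorem extendZero_testVector_of_ne {i₀ i : Fin ν} (h : i ≠ i₀) (j : Fin (k i)) :
    extendZero (testVector k i₀) i j = 0 := by
  simp [extendZero, testVector, h]

theorem extendZero_testVector_self (i₀ : Fin ν) (j : Fin (k i₀)) :
    extendZero (testVector k i₀) i₀ j = if (j : ℕ) + 1 < k i₀ then 1 else 0 := by
  simp [extendZero, testVector]

theorem card_filter_val_add_one_lt (n : ℕ) :
    (Finset.univ.filter fun j : Fin n => (j : ℕ) + 1 < n).card = n - 1 := by
  simp only [← Nat.lt_sub_iff_add_lt, Fin.card_filter_val_lt, Nat.sub_le, min_eq_right]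

theorem sum_testVector_sq (i₀ : Fin ν) (hk : 0 < k i₀) :
    ∑ r, testVector k i₀ r ^ 2 = k i₀ := by
  rw [sum_sq_eq_sum_extendZero_sq, Fintype.sum_eq_single i₀ fun i hi => by
    simp only [extendZero_testVector_of_ne hi, zero_pow two_ne_zero, Finset.sum_const_zero]]
  simp only [extendZero_testVector_self, ite_pow, one_pow, zero_pow two_ne_zero, Finset.sum_boole,
    card_filter_val_add_one_lt, testVector, neg_sq]
  rw [Nat.cast_sub hk]
  ring

theorem sum_sectionMatrix_mul_testVector (i₀ : Fin ν) (J : Cell k) :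
    ∑ r, sectionMatrix k r J * testVector k i₀ r =
      -if (J i₀ : ℕ) + 1 < k i₀ then 0 else 1 := by
  rw [sum_sectionMatrix_mul, Fintype.sum_eq_single i₀ fun i hi => extendZero_testVector_of_ne hi _,
    extendZero_testVector_self, testVector]
  split_ifs <;> norm_num

theorem natCast_mul_sum_cell_testVector_sq (i₀ : Fin ν) (hk : 0 < k i₀) :
    k i₀ * ∑ J : Cell k, (∑ r, sectionMatrix k r J * testVector k i₀ r) ^ 2 =
      ∏ i, (k i : ℝ) := by
  have hlast : ∑ j : Fin (k i₀), (if (j : ℕ) + 1 < k i₀ then (0 : ℝ) else 1) = 1 := by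
    rw [Fintype.sum_eq_single (⟨k i₀ - 1, Nat.sub_one_lt hk.ne'⟩ : Fin (k i₀))]
    · exact if_neg (by simp only; lia)
    · exact fun j hj => if_pos (by have := Fin.val_ne_of_ne hj; simp only at this; lia)
  have hslice := card_mul_sum_pi_comp_eval (α := fun i => Fin (k i)) i₀
    (fun j => if (j : ℕ) + 1 < k i₀ then (0 : ℝ) else 1)
  simp only [hlast, Fintype.card_fin, mul_one] at hslice
  simpa only [sum_sectionMatrix_mul_testVector, neg_sq, ite_pow, zero_pow two_ne_zero,
    one_pow] using hslice

end SectionMatrix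

section GaussianFormula

variable {R ι : Type*} [Fintype R] [Fintype ι] {A : Matrix R ι ℝ}
  {z : EuclideanSpace ℝ ι}

section EuclideanLin

variable [DecidableEq R]

theorem halfSq_columnForm (A : Matrix R ι ℝ) (z : EuclideanSpace ℝ ι) (ξ : EuclideanSpace ℝ R) :
    halfSq (columnForm A z) ξ =
      1 / 2 * ‖Matrix.toEuclideanLin ((2 * Real.pi) • (scaledMatrix A z)ᵀ) ξ‖ ^ 2 := by
  rw [halfSq, EuclideanSpace.real_norm_sq_eq]
  refine congrArg _ (Finset.sum_congr rfl fun j _ => congrArg (· ^ 2) ?_)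
  change _ = ∑ r, 2 * Real.pi * (z j * A r j) * ξ r
  simp only [columnForm_apply, Finset.mul_sum, mul_assoc]

theorem det_mul_transpose_pos_of_halfSq_pos
    (hpos : ∀ ξ, ξ ≠ 0 → 0 < halfSq (columnForm A z) ξ) : 0 < (A * Aᵀ).det := by
  have hinj : Function.Injective (Matrix.toEuclideanLin Aᵀ) := by
    refine (injective_iff_map_eq_zero _).2 fun ξ hξ => of_not_not fun hne => ?_
    have hsum : ∀ j, ∑ r, A r j * ξ r = 0 := congrFun (congrArg WithLp.ofLp hξ)
    exact (hpos ξ hne).ne' (by simp [halfSq, columnForm_apply, hsum])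
  have hsq := normDet_toEuclideanLin_sq Aᵀ
  rw [Matrix.transpose_transpose] at hsq
  exact hsq ▸ pow_pos (normDet_pos_of_injective hinj) 2

theorem injective_scaledMatrix_of_halfSq_pos
    (hpos : ∀ ξ, ξ ≠ 0 → 0 < halfSq (columnForm A z) ξ) :
    Function.Injective (Matrix.toEuclideanLin ((2 * Real.pi) • (scaledMatrix A z)ᵀ)) :=
  (injective_iff_map_eq_zero _).2 fun ξ hξ => of_not_not fun hne =>
    (hpos ξ hne).ne' (by rw [halfSq_columnForm, hξ]; simp)

theorem normDet_scaledMatrix (A : Matrix R ι ℝ) (z : EuclideanSpace ℝ ι) :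
    (Matrix.toEuclideanLin ((2 * Real.pi) • (scaledMatrix A z)ᵀ)).normDet =
      (2 * Real.pi) ^ Fintype.card R * √(scaledMatrix A z * (scaledMatrix A z)ᵀ).det := by
  have hsq := normDet_toEuclideanLin_sq ((2 * Real.pi) • (scaledMatrix A z)ᵀ)
  rw [Matrix.transpose_smul, Matrix.transpose_transpose, Matrix.smul_mul, Matrix.mul_smul,
    smul_smul, ← sq, Matrix.det_smul, pow_right_comm] at hsq
  rw [← Real.sqrt_sq (LinearMap.normDet_nonneg _), hsq, Real.sqrt_mul (by positivity),
    Real.sqrt_sq (by positivity)]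

end EuclideanLin

theorem integrable_exp_neg_halfSq_columnForm
    (hpos : ∀ ξ, ξ ≠ 0 → 0 < halfSq (columnForm A z) ξ) :
    Integrable fun ξ => Real.exp (-halfSq (columnForm A z) ξ) := by
  classical
  simp_rw [halfSq_columnForm]
  exact integrable_exp_neg_half_sq_norm (injective_scaledMatrix_of_halfSq_pos hpos)

variable [DecidableEq R]

theorem gaussianFormula_nonneg (A : Matrix R ι ℝ) (z : EuclideanSpace ℝ ι) :
    0 ≤ gaussianFormula A z := by
  unfold gaussianFormula; positivity

theorem gaussianFormula_eq_integral (hpos : ∀ ξ, ξ ≠ 0 → 0 < halfSq (columnForm A z) ξ) :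
    gaussianFormula A z = Real.exp (entropy z) * √(A * Aᵀ).det *
      ∫ ξ, Real.exp (-halfSq (columnForm A z) ξ) := by
  have hinj := injective_scaledMatrix_of_halfSq_pos hpos
  have hdet : 0 < √(scaledMatrix A z * (scaledMatrix A z)ᵀ).det :=
    pos_of_mul_pos_right (normDet_scaledMatrix A z ▸ normDet_pos_of_injective hinj)
      (by positivity)
  have hpow : (2 * Real.pi) ^ Fintype.card R =
      (2 * Real.pi) ^ ((Fintype.card R : ℝ) / 2) * (2 * Real.pi) ^ ((Fintype.card R : ℝ) / 2) := by
    rw [← Real.rpow_add Real.two_pi_pos, add_halves, Real.rpow_natCast]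
  simp_rw [halfSq_columnForm]
  rw [integral_exp_neg_half_sq_norm hinj, finrank_euclideanSpace, normDet_scaledMatrix, hpow,
    gaussianFormula, Real.sqrt_div (det_mul_transpose_nonneg A)]
  field_simp

theorem abs_gaussianFormula_sub_vol_le {b : R → ℝ} (hz : IsAnalyticCenter (polyhedron A b) z)
    (hpos : ∀ ξ, ξ ≠ 0 → 0 < halfSq (columnForm A z) ξ) {κ p : ℝ} (hκ : 0 < κ)
    (hu : ∀ j ξ, columnForm A z j ξ ^ 2 ≤ κ * halfSq (columnForm A z) ξ)
    (hp : p = (Fintype.card R + 3 : ℝ) / 2) (hpκ : p ^ 2 * κ ≤ 1 / 2) :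
    |gaussianFormula A z - vol (Fintype.card ι - Fintype.card R) (polyhedron A b)| ≤
      Fintype.card ι * (24 * Real.exp (1 / 4) * √κ ^ 3) * gaussianFormula A z := by
  have hint := integrable_exp_neg_halfSq_columnForm hpos
  have : (0 : ℝ) ≤ Fintype.card R := Nat.cast_nonneg _
  have hcharProd : Integrable (charProd (columnForm A z)) :=
    integrable_charProd volume _ hκ hu hint (by rw [finrank_euclideanSpace]; nlinarith)
  have herror := norm_integral_charProd_sub_le volume _ hpos hκ hu hint
    (by rw [finrank_euclideanSpace]; exact hp) hpκ
  have hvol := vol_polyhedron_eq_integral (det_mul_transpose_pos_of_halfSq_pos hpos).ne' hz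
    hcharProd
  have hG := gaussianFormula_eq_integral hpos
  rw [← Complex.ofReal_mul] at hvol
  set c := Real.exp (entropy z) * √(A * Aᵀ).det
  have hc₀ : 0 ≤ c := by positivity
  rw [abs_sub_comm, ← Real.norm_eq_abs, ← Complex.norm_real, Complex.ofReal_sub, hvol, hG,
    Complex.ofReal_mul c, ← mul_sub, norm_mul, Complex.norm_real, Real.norm_of_nonneg hc₀]
  exact (mul_le_mul_of_nonneg_left herror hc₀).trans_eq (by ring)

end GaussianFormula

section MomentForm

variable {R ι : Type*} [Fintype R] [Fintype ι] {A : Matrix R ι ℝ} {z : EuclideanSpace ℝ ι}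

theorem halfSq_columnForm_eq_momentForm (A : Matrix R ι ℝ) (z : EuclideanSpace ℝ ι)
    (ξ : EuclideanSpace ℝ R) :
    halfSq (columnForm A z) ξ = 4 * Real.pi ^ 2 * momentForm A z ξ.ofLp := by
  rw [momentForm_apply, halfSq, Finset.mul_sum, Finset.mul_sum, Finset.mul_sum]
  refine Finset.sum_congr rfl fun j _ => ?_
  rw [columnForm_apply]
  ring

theorem mul_sum_sq_le_momentForm {δ : ℝ} (hδ : 0 ≤ δ) (hz : ∀ j, δ ≤ z j) (t : R → ℝ) :
    δ ^ 2 / 2 * ∑ j, (∑ r, A r j * t r) ^ 2 ≤ momentForm A z t := by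
  rw [momentForm_apply, Finset.mul_sum, Finset.mul_sum]
  refine Finset.sum_le_sum fun j _ => ?_
  have hsq : δ ^ 2 ≤ z j ^ 2 := pow_le_pow_left₀ hδ (hz j) 2
  nlinarith [mul_le_mul_of_nonneg_right hsq (sq_nonneg (∑ r, A r j * t r))]

theorem momentForm_le_mul_sum_sq {Δ : ℝ} (hz₀ : ∀ j, 0 ≤ z j) (hz : ∀ j, z j ≤ Δ) (t : R → ℝ) :
    momentForm A z t ≤ Δ ^ 2 / 2 * ∑ j, (∑ r, A r j * t r) ^ 2 := by
  rw [momentForm_apply, Finset.mul_sum, Finset.mul_sum]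
  refine Finset.sum_le_sum fun j _ => ?_
  have hsq : z j ^ 2 ≤ Δ ^ 2 := pow_le_pow_left₀ (hz₀ j) (hz j) 2
  nlinarith [mul_le_mul_of_nonneg_right hsq (sq_nonneg (∑ r, A r j * t r))]

end MomentForm

section SectionMatrixBounds

variable {ν : ℕ} {k : Fin ν → ℕ} {z : EuclideanSpace ℝ (Cell k)} {δ Δ M : ℝ}

theorem mul_sum_sq_le_momentForm_sectionMatrix (hk : ∀ i, 0 < k i) (hM₁ : 1 ≤ M)
    (hM : ∀ i, (k i : ℝ) ≤ M) (hδ : 0 ≤ δ) (hz : ∀ J, δ ≤ z J) (t : Eqn k → ℝ) :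
    δ ^ 2 * (∏ i, (k i : ℝ)) / (2 * (ν + 3) * M ^ 2) * ∑ r, t r ^ 2 ≤
      momentForm (sectionMatrix k) z t := by
  have hform := mul_sum_sq_le_momentForm (A := sectionMatrix k) hδ hz t
  rw [sum_cell_sq_eq hk] at hform
  refine le_trans ?_ hform
  calc δ ^ 2 * (∏ i, (k i : ℝ)) / (2 * (ν + 3) * M ^ 2) * ∑ r, t r ^ 2
      ≤ δ ^ 2 * (∏ i, (k i : ℝ)) / (2 * (ν + 3) * M ^ 2) *
          ((ν + 3) * M ^ 2 * sectionEnergy t) := by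
        gcongr
        exact sum_sq_le_sectionEnergy hk hM₁ hM t
    _ = δ ^ 2 / 2 * ((∏ i, (k i : ℝ)) * sectionEnergy t) := by field_simp

theorem halfSq_columnForm_sectionMatrix_pos (hk : ∀ i, 0 < k i) (hM₁ : 1 ≤ M)
    (hM : ∀ i, (k i : ℝ) ≤ M) (hδ : 0 < δ) (hz : ∀ J, δ ≤ z J) {ξ : EuclideanSpace ℝ (Eqn k)}
    (hξ : ξ ≠ 0) : 0 < halfSq (columnForm (sectionMatrix k) z) ξ := by
  have hprod : 0 < ∏ i, (k i : ℝ) := Finset.prod_pos fun i _ => Nat.cast_pos.2 (hk i)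
  have hsq : 0 < ∑ r, ξ r ^ 2 := by
    rw [← EuclideanSpace.real_norm_sq_eq]
    positivity
  have hform := mul_sum_sq_le_momentForm_sectionMatrix hk hM₁ hM hδ.le hz ξ.ofLp
  rw [halfSq_columnForm_eq_momentForm]
  exact mul_pos (by positivity) (lt_of_lt_of_le (by positivity) hform)

theorem columnForm_sectionMatrix_sq_le (hk : ∀ i, 0 < k i) (hM₁ : 1 ≤ M)
    (hM : ∀ i, (k i : ℝ) ≤ M) (hδ : 0 < δ) (hz : ∀ J, δ ≤ z J ∧ z J ≤ Δ) (J : Cell k)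
    (ξ : EuclideanSpace ℝ (Eqn k)) :
    columnForm (sectionMatrix k) z J ξ ^ 2 ≤
      2 * Δ ^ 2 * ((ν + 1) * M) / (δ ^ 2 * ∏ i, (k i : ℝ)) *
        halfSq (columnForm (sectionMatrix k) z) ξ := by
  have hprod : 0 < ∏ i, (k i : ℝ) := Finset.prod_pos fun i _ => Nat.cast_pos.2 (hk i)
  have hform := mul_sum_sq_le_momentForm (A := sectionMatrix k) hδ.le (fun J => (hz J).1) ξ.ofLp
  rw [sum_cell_sq_eq hk] at hform
  have hzJ : z J ^ 2 ≤ Δ ^ 2 := pow_le_pow_left₀ (hδ.le.trans (hz J).1) (hz J).2 2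
  rw [columnForm_apply, halfSq_columnForm_eq_momentForm]
  calc (2 * Real.pi * z J * ∑ r, sectionMatrix k r J * ξ r) ^ 2
      = 4 * Real.pi ^ 2 * (z J ^ 2 * (∑ r, sectionMatrix k r J * ξ r) ^ 2) := by ring
    _ ≤ 4 * Real.pi ^ 2 * (Δ ^ 2 * ((ν + 1) * M * sectionEnergy ξ.ofLp)) := by
        gcongr
        exact sq_sum_sectionMatrix_mul_le hk hM₁ hM ξ.ofLp J
    _ = 2 * Δ ^ 2 * ((ν + 1) * M) / (δ ^ 2 * ∏ i, (k i : ℝ)) * (4 * Real.pi ^ 2 *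
          (δ ^ 2 / 2 * ((∏ i, (k i : ℝ)) * sectionEnergy ξ.ofLp))) := by field_simp
    _ ≤ 2 * Δ ^ 2 * ((ν + 1) * M) / (δ ^ 2 * ∏ i, (k i : ℝ)) *
          (4 * Real.pi ^ 2 * momentForm (sectionMatrix k) z ξ.ofLp) := by gcongr

theorem le_of_isSmallestEigenvalue_momentForm (hk : ∀ i, 0 < k i) (hM₁ : 1 ≤ M)
    (hM : ∀ i, (k i : ℝ) ≤ M) (hδ : 0 ≤ δ) (hz : ∀ J, δ ≤ z J) {l : ℝ}
    (hl : IsSmallestEigenvalue (momentForm (sectionMatrix k) z) l) :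
    δ ^ 2 * (∏ i, (k i : ℝ)) / (2 * (ν + 3) * M ^ 2) ≤ l :=
  le_of_hasEigenvalue (mul_sum_sq_le_momentForm_sectionMatrix hk hM₁ hM hδ hz) hl.1

theorem exists_isSmallestEigenvalue_momentForm_le (hz₀ : ∀ J, 0 ≤ z J) (hz : ∀ J, z J ≤ Δ)
    {i₀ : Fin ν} (hk : 0 < k i₀) :
    ∃ l, IsSmallestEigenvalue (momentForm (sectionMatrix k) z) l ∧
      l ≤ Δ ^ 2 * (∏ i, (k i : ℝ)) / (2 * (k i₀ : ℝ) ^ 2) := by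
  obtain ⟨l, hl, hle⟩ := exists_isSmallestEigenvalue (momentForm (sectionMatrix k) z)
  have hk' : (0 : ℝ) < k i₀ := Nat.cast_pos.2 hk
  refine ⟨l, hl, (le_div_iff₀ (by positivity)).2 ?_⟩
  have htest := (hle (testVector k i₀)).trans (momentForm_le_mul_sum_sq hz₀ hz _)
  rw [sum_testVector_sq i₀ hk] at htest
  rw [← natCast_mul_sum_cell_testVector_sq i₀ hk]
  nlinarith [mul_le_mul_of_nonneg_left htest hk'.le]

end SectionMatrixBounds

section SizeBounds

variable {ν : ℕ} {k : Fin ν → ℕ} {a b : ℝ} {n : ℕ}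

theorem card_eqn (k : Fin ν → ℕ) : Fintype.card (Eqn k) = (∑ i, (k i - 1)) + 1 := by
  simp only [Fintype.card_option, Fintype.card_sigma, Fintype.card_subtype,
    card_filter_val_add_one_lt]

theorem card_cell (k : Fin ν → ℕ) : Fintype.card (Cell k) = ∏ i, k i := by
  simp only [Fintype.card_pi, Fintype.card_fin]

theorem card_eqn_le (hb : ∀ i, (k i : ℝ) ≤ b * n) :
    (Fintype.card (Eqn k) : ℝ) ≤ ν * (b * n) + 1 := by
  rw [card_eqn, Nat.cast_add_one, Nat.cast_sum]
  have hsum : ∑ i, ((k i - 1 : ℕ) : ℝ) ≤ ∑ _i : Fin ν, b * n :=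
    Finset.sum_le_sum fun i _ => (Nat.cast_le.2 (Nat.sub_le _ _)).trans (hb i)
  simpa using hsum

theorem mul_pow_le_prod (ha : 0 ≤ a) (hak : ∀ i, a * n ≤ k i) :
    a ^ ν * (n : ℝ) ^ ν ≤ ∏ i, (k i : ℝ) := by
  have hprod := Finset.prod_le_prod (s := Finset.univ) (f := fun _ : Fin ν => a * n)
    (fun i _ => by positivity) fun i _ => hak i
  simpa [mul_pow] using hprod

theorem prod_le_mul_pow (hkb : ∀ i, (k i : ℝ) ≤ b * n) :
    ∏ i, (k i : ℝ) ≤ b ^ ν * (n : ℝ) ^ ν := by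
  have hprod := Finset.prod_le_prod (s := Finset.univ) (g := fun _ : Fin ν => b * n)
    (fun i _ => Nat.cast_nonneg (k i)) fun i _ => hkb i
  simpa [mul_pow] using hprod

theorem one_le_mul_of_natCast_le {m : ℕ} (hm : 0 < m) (h : (m : ℝ) ≤ b * n) : 1 ≤ b * n :=
  (Nat.one_le_cast.2 hm).trans h

theorem pos_of_one_le_mul_natCast (h : 1 ≤ b * n) : 0 < b ∧ 0 < (n : ℝ) := by
  have hb : 0 < b := pos_of_mul_pos_left (one_pos.trans_le h) n.cast_nonneg
  exact ⟨hb, pos_of_mul_pos_right (one_pos.trans_le h) hb.le⟩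

theorem pos_of_upper_bounds {z : EuclideanSpace ℝ (Cell k)} {δ Δ : ℝ} (hν : 0 < ν) (hδ : 0 < δ)
    (hk : ∀ i, 0 < k i) (hkb : ∀ i, (k i : ℝ) ≤ b * n) (hz : ∀ J, δ ≤ z J ∧ z J ≤ Δ) :
    0 < b ∧ 0 < Δ := by
  obtain ⟨hδJ, hJΔ⟩ := hz fun i => ⟨0, hk i⟩
  exact ⟨(pos_of_one_le_mul_natCast
    (one_le_mul_of_natCast_le (hk ⟨0, hν⟩) (hkb ⟨0, hν⟩))).1, hδ.trans_le (hδJ.trans hJΔ)⟩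

end SizeBounds

section SmallestEigenvalue

variable {ν : ℕ} {k : Fin ν → ℕ} {z : EuclideanSpace ℝ (Cell k)} {a b δ Δ : ℝ} {n : ℕ}

theorem isSmallestEigenvalue_momentForm_bounds (hν : 2 ≤ ν) (ha : 0 < a) (hδ : 0 < δ)
    (hk : ∀ i, 0 < k i) (hab : ∀ i, a * n ≤ k i ∧ (k i : ℝ) ≤ b * n)
    (hz : ∀ J, δ ≤ z J ∧ z J ≤ Δ) :
    ∃ l, IsSmallestEigenvalue (momentForm (sectionMatrix k) z) l ∧
      δ ^ 2 * a ^ ν / (2 * (ν + 3) * b ^ 2) * (n : ℝ) ^ (ν - 2) ≤ l ∧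
      l ≤ Δ ^ 2 * b ^ ν / (2 * a ^ 2) * (n : ℝ) ^ (ν - 2) := by
  let i₀ : Fin ν := ⟨0, by lia⟩
  have hbn := one_le_mul_of_natCast_le (hk i₀) (hab i₀).2
  obtain ⟨hb, hn⟩ := pos_of_one_le_mul_natCast hbn
  have hpow : (n : ℝ) ^ ν = (n : ℝ) ^ (ν - 2) * (n : ℝ) ^ 2 := by
    rw [← pow_add, Nat.sub_add_cancel hν]
  obtain ⟨l, hl, hupper⟩ := exists_isSmallestEigenvalue_momentForm_le
    (fun J => hδ.le.trans (hz J).1) (fun J => (hz J).2) (hk i₀)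
  have hlower := le_of_isSmallestEigenvalue_momentForm hk hbn (fun i => (hab i).2) hδ.le
    (fun J => (hz J).1) hl
  refine ⟨l, hl, le_trans ?_ hlower, hupper.trans ?_⟩
  · calc δ ^ 2 * a ^ ν / (2 * (ν + 3) * b ^ 2) * (n : ℝ) ^ (ν - 2)
        = δ ^ 2 * (a ^ ν * (n : ℝ) ^ ν) / (2 * (ν + 3) * (b * n) ^ 2) := by
          rw [hpow]; field_simp
      _ ≤ δ ^ 2 * (∏ i, (k i : ℝ)) / (2 * (ν + 3) * (b * n) ^ 2) := by
          gcongr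
          exact mul_pow_le_prod ha.le fun i => (hab i).1
  · calc Δ ^ 2 * (∏ i, (k i : ℝ)) / (2 * (k i₀ : ℝ) ^ 2)
        ≤ Δ ^ 2 * (b ^ ν * (n : ℝ) ^ ν) / (2 * (a * n) ^ 2) := by
          gcongr
          · exact prod_le_mul_pow fun i => (hab i).2
          · exact (hab i₀).1
      _ = Δ ^ 2 * b ^ ν / (2 * a ^ 2) * (n : ℝ) ^ (ν - 2) := by
          rw [hpow]; field_simp

theorem exists_forall_isSmallestEigenvalue_bounds (hν : 2 ≤ ν) (b Δ : ℝ) (ha : 0 < a)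
    (hδ : 0 < δ) :
    ∃ c C : ℝ, 0 < c ∧ 0 < C ∧
      ∀ (n : ℕ) (k : Fin ν → ℕ) (z : EuclideanSpace ℝ (Cell k)), (∀ i, 0 < k i) →
        (∀ i, a * n ≤ k i ∧ (k i : ℝ) ≤ b * n) → (∀ J, δ ≤ z J ∧ z J ≤ Δ) →
        ∃ l, IsSmallestEigenvalue (momentForm (sectionMatrix k) z) l ∧
          c * (n : ℝ) ^ (ν - 2) ≤ l ∧ l ≤ C * (n : ℝ) ^ (ν - 2) := by
  by_cases hpos : 0 < b ∧ 0 < Δ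
  · obtain ⟨hb, hΔ⟩ := hpos
    exact ⟨δ ^ 2 * a ^ ν / (2 * (ν + 3) * b ^ 2), Δ ^ 2 * b ^ ν / (2 * a ^ 2), by positivity,
      by positivity, fun n k z hk hab hz =>
        isSmallestEigenvalue_momentForm_bounds hν ha hδ hk hab hz⟩
  · exact ⟨1, 1, one_pos, one_pos, fun n k z hk hab hz =>
      absurd (pos_of_upper_bounds (two_pos.trans_le hν) hδ hk (fun i => (hab i).2) hz) hpos⟩

end SmallestEigenvalue

section ErrorBounds

variable {ν : ℕ}

theorem tendsto_pow_three_div_pow (hν : 4 ≤ ν) :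
    Tendsto (fun n : ℕ => (n : ℝ) ^ 3 / (n : ℝ) ^ ν) atTop (𝓝 0) :=
  (tendsto_pow_div_pow_atTop_zero hν).comp tendsto_natCast_atTop_atTop

theorem tendsto_sq_mul_div_pow (hν : 4 ≤ ν) (P D : ℝ) :
    Tendsto (fun n : ℕ => (P * n) ^ 2 * (D * (n / (n : ℝ) ^ ν))) atTop (𝓝 0) := by
  have hlim := (tendsto_pow_three_div_pow hν).const_mul (P ^ 2 * D)
  rw [mul_zero] at hlim
  exact hlim.congr fun n => by ring

theorem tendsto_pow_mul_sqrt_pow_three (hν : 4 ≤ ν) {D : ℝ} (hD : 0 ≤ D) :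
    Tendsto (fun n : ℕ => (n : ℝ) ^ ν * √(D * (n / (n : ℝ) ^ ν)) ^ 3) atTop (𝓝 0) := by
  have hlim := ((tendsto_pow_three_div_pow hν).const_mul (D ^ 3)).sqrt
  rw [mul_zero, Real.sqrt_zero] at hlim
  refine hlim.congr' ((eventually_gt_atTop 0).mono fun n hn => ?_)
  have : (0 : ℝ) < n := Nat.cast_pos.2 hn
  refine (Real.sqrt_eq_iff_mul_self_eq (by positivity) (by positivity)).2 (Eq.symm ?_)
  calc (n : ℝ) ^ ν * √(D * (n / (n : ℝ) ^ ν)) ^ 3 * ((n : ℝ) ^ ν * √(D * (n / (n : ℝ) ^ ν)) ^ 3)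
      = ((n : ℝ) ^ ν) ^ 2 * (√(D * (n / (n : ℝ) ^ ν)) ^ 2) ^ 3 := by ring
    _ = D ^ 3 * ((n : ℝ) ^ 3 / (n : ℝ) ^ ν) := by
        rw [Real.sq_sqrt (by positivity)]
        field_simp

variable {a b δ Δ : ℝ}

theorem exists_forall_columnForm_sq_le (hν : 0 < ν) (b Δ : ℝ) (ha : 0 < a) (hδ : 0 < δ) :
    ∃ D : ℝ, 0 < D ∧
      ∀ (n : ℕ) (k : Fin ν → ℕ) (z : EuclideanSpace ℝ (Cell k)), (∀ i, 0 < k i) →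
        (∀ i, a * n ≤ k i ∧ (k i : ℝ) ≤ b * n) → (∀ J, δ ≤ z J ∧ z J ≤ Δ) →
        ∀ J ξ, columnForm (sectionMatrix k) z J ξ ^ 2 ≤
          D * (n / (n : ℝ) ^ ν) * halfSq (columnForm (sectionMatrix k) z) ξ := by
  by_cases hpos : 0 < b ∧ 0 < Δ
  · obtain ⟨hb, hΔ⟩ := hpos
    refine ⟨2 * Δ ^ 2 * ((ν + 1) * b) / (δ ^ 2 * a ^ ν), by positivity,
      fun n k z hk hab hz J ξ => ?_⟩
    have hbn := one_le_mul_of_natCast_le (hk ⟨0, hν⟩) (hab ⟨0, hν⟩).2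
    have hn := (pos_of_one_le_mul_natCast hbn).2
    refine (columnForm_sectionMatrix_sq_le hk hbn (fun i => (hab i).2) hδ hz J ξ).trans
      (mul_le_mul_of_nonneg_right ?_ (halfSq_nonneg _ _))
    calc 2 * Δ ^ 2 * ((ν + 1) * (b * n)) / (δ ^ 2 * ∏ i, (k i : ℝ))
        ≤ 2 * Δ ^ 2 * ((ν + 1) * (b * n)) / (δ ^ 2 * (a ^ ν * (n : ℝ) ^ ν)) := by
          gcongr
          exact mul_pow_le_prod ha.le fun i => (hab i).1
      _ = 2 * Δ ^ 2 * ((ν + 1) * b) / (δ ^ 2 * a ^ ν) * (n / (n : ℝ) ^ ν) := by ring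
  · exact ⟨1, one_pos, fun n k z hk hab hz =>
      absurd (pos_of_upper_bounds hν hδ hk (fun i => (hab i).2) hz) hpos⟩

theorem exists_forall_abs_gaussianFormula_sub_vol_le_mul_gaussianFormula (hν : 4 ≤ ν) (b Δ : ℝ)
    (ha : 0 < a) (hδ : 0 < δ) {ε : ℝ} (hε : 0 < ε) :
    ∃ n₀ : ℕ, ∀ (n : ℕ) (k : Fin ν → ℕ) (N : ℝ) (β : (i : Fin ν) → Fin (k i) → ℝ)
      (z : EuclideanSpace ℝ (Cell k)), n₀ ≤ n → (∀ i, 0 < k i) →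
      (∀ i, a * n ≤ k i ∧ (k i : ℝ) ≤ b * n) → IsAnalyticCenter (transportPolytope k N β) z →
      (∀ J, δ ≤ z J ∧ z J ≤ Δ) →
      |gaussianFormula (sectionMatrix k) z -
          vol ((∏ i, k i) - ((∑ i, (k i - 1)) + 1)) (transportPolytope k N β)| ≤
        ε * gaussianFormula (sectionMatrix k) z := by
  have hν₀ : 0 < ν := by lia
  obtain ⟨D, hD, hleverage⟩ := exists_forall_columnForm_sq_le hν₀ b Δ ha hδ
  have herror := (tendsto_pow_mul_sqrt_pow_three hν hD.le).const_mul
    (b ^ ν * (24 * Real.exp (1 / 4)))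
  rw [mul_zero] at herror
  obtain ⟨n₀, hn₀⟩ := eventually_atTop.1
    (((tendsto_sq_mul_div_pow hν ((ν * b + 4) / 2) D).eventually_le_const one_half_pos).and
      (herror.eventually_le_const hε))
  refine ⟨n₀, fun n k N β z hn hk hab hz hzb => ?_⟩
  obtain ⟨hdegree, hsmall⟩ := hn₀ n hn
  have hkb : ∀ i, (k i : ℝ) ≤ b * n := fun i => (hab i).2
  have hbn := one_le_mul_of_natCast_le (hk ⟨0, hν₀⟩) (hkb ⟨0, hν₀⟩)
  obtain ⟨_, hn'⟩ := pos_of_one_le_mul_natCast hbn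
  have hn₁ : (1 : ℝ) ≤ n := Nat.one_le_cast.2 (Nat.cast_pos.1 hn')
  have hp : (Fintype.card (Eqn k) + 3 : ℝ) / 2 ≤ (ν * b + 4) / 2 * n := by
    linarith [card_eqn_le hkb]
  have hκ : 0 < D * (n / (n : ℝ) ^ ν) := by positivity
  have hmain := abs_gaussianFormula_sub_vol_le hz
    (fun ξ => halfSq_columnForm_sectionMatrix_pos hk hbn hkb hδ fun J => (hzb J).1) hκ
    (hleverage n k z hk hab hzb) rfl (le_trans (by gcongr) hdegree)
  rw [card_cell, card_eqn, Nat.cast_prod] at hmain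
  refine hmain.trans (mul_le_mul_of_nonneg_right (le_trans ?_ hsmall) (gaussianFormula_nonneg _ _))
  calc (∏ i, (k i : ℝ)) * (24 * Real.exp (1 / 4) * √(D * (n / (n : ℝ) ^ ν)) ^ 3)
      ≤ b ^ ν * (n : ℝ) ^ ν * (24 * Real.exp (1 / 4) * √(D * (n / (n : ℝ) ^ ν)) ^ 3) := by
        gcongr
        exact prod_le_mul_pow hkb
    _ = b ^ ν * (24 * Real.exp (1 / 4)) * ((n : ℝ) ^ ν * √(D * (n / (n : ℝ) ^ ν)) ^ 3) := by ring

theorem abs_sub_le_mul_of_abs_sub_le_div_mul {x y ε : ℝ} (hε : 0 ≤ ε)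
    (h : |x - y| ≤ ε / (1 + ε) * x) : |x - y| ≤ ε * y := by
  have hxy : x - ε / (1 + ε) * x ≤ y := by linarith [le_abs_self (x - y)]
  calc |x - y| ≤ ε / (1 + ε) * x := h
    _ = ε * (x - ε / (1 + ε) * x) := by field_simp; ring
    _ ≤ ε * y := by gcongr

theorem exists_forall_abs_gaussianFormula_sub_vol_le_mul_vol (hν : 4 ≤ ν) (b Δ : ℝ)
    (ha : 0 < a) (hδ : 0 < δ) {ε : ℝ} (hε : 0 < ε) :
    ∃ n₀ : ℕ, ∀ (n : ℕ) (k : Fin ν → ℕ) (N : ℝ) (β : (i : Fin ν) → Fin (k i) → ℝ)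
      (z : EuclideanSpace ℝ (Cell k)), n₀ ≤ n → (∀ i, 0 < k i) →
      (∀ i, a * n ≤ k i ∧ (k i : ℝ) ≤ b * n) → IsAnalyticCenter (transportPolytope k N β) z →
      (∀ J, δ ≤ z J ∧ z J ≤ Δ) →
      |gaussianFormula (sectionMatrix k) z -
          vol ((∏ i, k i) - ((∑ i, (k i - 1)) + 1)) (transportPolytope k N β)| ≤
        ε * vol ((∏ i, k i) - ((∑ i, (k i - 1)) + 1)) (transportPolytope k N β) := by
  obtain ⟨n₀, h⟩ := exists_forall_abs_gaussianFormula_sub_vol_le_mul_gaussianFormula hν b Δ ha hδ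
    (div_pos hε (add_pos one_pos hε))
  exact ⟨n₀, fun n k N β z hn hk hab hz hzb =>
    abs_sub_le_mul_of_abs_sub_le_div_mul hε.le (h n k N β z hn hk hab hz hzb)⟩

end ErrorBounds

section Polystochastic

variable {ν : ℕ}

theorem mem_transportPolytope_iff {k : Fin ν → ℕ} {N : ℝ} {β : (i : Fin ν) → Fin (k i) → ℝ}
    {x : EuclideanSpace ℝ (Cell k)} :
    x ∈ transportPolytope k N β ↔
      (∑ J, x J = N ∧ ∀ i (j : Fin (k i)), (j : ℕ) + 1 < k i →
        ∑ J ∈ Finset.univ.filter (fun J : Cell k => J i = j), x J = β i j) ∧ ∀ J, 0 ≤ x J := by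
  simp [transportPolytope, polyhedron, sectionMatrix, sectionRhs, Option.forall, Sigma.forall,
    Finset.sum_filter]

theorem eq_of_sum_eq_of_forall_ne_last {k : ℕ} {g : Fin k → ℝ} {c : ℝ} (hsum : ∑ j, g j = k * c)
    (h : ∀ j : Fin k, (j : ℕ) + 1 < k → g j = c) (j : Fin k) : g j = c := by
  by_cases hj : (j : ℕ) + 1 < k
  · exact h j hj
  · have hdev : ∑ j', (g j' - c) = 0 := by simp [hsum]
    rw [Fintype.sum_eq_single j fun j' hj' => sub_eq_zero.2 (h j' (by lia))] at hdev
    exact sub_eq_zero.1 hdev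

theorem sum_eq_of_forall_slice {k : ℕ} {x : (Fin ν → Fin k) → ℝ} {c : ℝ} (i : Fin ν)
    (h : ∀ j, ∑ J ∈ Finset.univ.filter (fun J : Fin ν → Fin k => J i = j), x J = c) :
    ∑ J, x J = k * c := by
  rw [← Finset.sum_fiberwise Finset.univ (fun J => J i), Finset.sum_congr rfl fun j _ => h j]
  simp

theorem transportPolytope_eq_polystochastic (hν : 0 < ν) (k : ℕ) :
    transportPolytope (fun _ : Fin ν => k) ((k : ℝ) ^ ν) (fun _ _ => (k : ℝ) ^ (ν - 1)) =
      polystochastic ν k := by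
  have hpow : (k : ℝ) * (k : ℝ) ^ (ν - 1) = (k : ℝ) ^ ν := mul_pow_sub_one hν.ne' _
  ext x
  rw [mem_transportPolytope_iff]
  constructor
  · rintro ⟨⟨htotal, hslice⟩, hx⟩
    refine ⟨hx, fun i => eq_of_sum_eq_of_forall_ne_last ?_ (hslice i)⟩
    rw [hpow, ← htotal]
    exact Finset.sum_fiberwise Finset.univ (fun J => J i) fun J => x J
  · rintro ⟨hx, hslice⟩
    exact ⟨⟨(sum_eq_of_forall_slice ⟨0, hν⟩ (hslice _)).trans hpow, fun i j _ => hslice i j⟩, hx⟩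

theorem ones_mem_polystochastic (ν k : ℕ) : WithLp.toLp 2 (fun _ => 1) ∈ polystochastic ν k := by
  refine ⟨fun J => zero_le_one, fun i j => ?_⟩
  have hcard := Fintype.card_filter_piFinset_const (ι := Fin ν) (Finset.univ : Finset (Fin k)) i j
  simp only [Fintype.piFinset_univ, Finset.mem_univ, if_true, Finset.card_univ,
    Fintype.card_fin] at hcard
  simp [hcard]

theorem isAnalyticCenter_polystochastic (hν : 0 < ν) (k : ℕ) :
    IsAnalyticCenter (polystochastic ν k) (WithLp.toLp 2 fun _ => 1) := by
  refine ⟨ones_mem_polystochastic ν k, fun J => zero_lt_one, fun x hx hpos => ?_⟩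
  have htotal : ∑ J, x J = (k : ℝ) ^ ν :=
    (sum_eq_of_forall_slice ⟨0, hν⟩ (hx.2 _)).trans (mul_pow_sub_one hν.ne' _)
  have hlog : ∑ J, Real.log (x J) ≤ 0 :=
    calc ∑ J, Real.log (x J) ≤ ∑ J, (x J - 1) :=
          Finset.sum_le_sum fun J _ => Real.log_le_sub_one_of_pos (hpos J)
      _ = 0 := by simp [htotal]
  simpa [entropy] using hlog

theorem gaussianFormula_ones {R ι : Type*} [Fintype R] [DecidableEq R] [Fintype ι]
    {A : Matrix R ι ℝ} (hA : (A * Aᵀ).det ≠ 0) :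
    gaussianFormula A (WithLp.toLp 2 fun _ => 1) =
      Real.exp (Fintype.card ι) / (2 * Real.pi) ^ ((Fintype.card R : ℝ) / 2) := by
  have hscaled : scaledMatrix A (WithLp.toLp 2 fun _ => 1) = A := by
    ext r j
    simp [scaledMatrix]
  rw [gaussianFormula, hscaled, div_self hA]
  simp [entropy, div_eq_inv_mul]

theorem gaussianFormula_polystochastic {k : ℕ} (hk : 0 < k) :
    gaussianFormula (sectionMatrix fun _ : Fin ν => k) (WithLp.toLp 2 fun _ => 1) =
      Real.exp ((k : ℝ) ^ ν) / (2 * Real.pi) ^ (((ν : ℝ) * k - ν + 1) / 2) := by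
  have hdet := det_mul_transpose_pos_of_halfSq_pos (z := WithLp.toLp 2 fun _ => 1) fun ξ =>
    halfSq_columnForm_sectionMatrix_pos (k := fun _ : Fin ν => k) (fun _ => hk)
      (Nat.one_le_cast.2 hk) (fun _ => le_rfl) one_pos fun _ => le_rfl
  rw [gaussianFormula_ones hdet.ne', card_cell, card_eqn]
  simp [Nat.cast_pred hk, mul_sub]

theorem tendsto_vol_polystochastic_div (hν : 4 ≤ ν) :
    Tendsto (fun k : ℕ =>
      vol (k ^ ν - (ν * (k - 1) + 1)) (polystochastic ν k) /
        (Real.exp ((k : ℝ) ^ ν) / (2 * Real.pi) ^ (((ν : ℝ) * k - ν + 1) / 2)))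
      atTop (𝓝 1) := by
  refine Metric.tendsto_atTop'.2 fun ε hε => ?_
  obtain ⟨n₀, hn₀⟩ := exists_forall_abs_gaussianFormula_sub_vol_le_mul_gaussianFormula hν 1 1
    one_pos one_pos (half_pos hε)
  refine ⟨n₀, fun k hk => ?_⟩
  have hν₀ : 0 < ν := by lia
  have hk₀ : 0 < k := by lia
  have h := hn₀ k (fun _ => k) ((k : ℝ) ^ ν) (fun _ _ => (k : ℝ) ^ (ν - 1))
    (WithLp.toLp 2 fun _ => 1) hk.le (fun _ => hk₀) (by simp)
    (transportPolytope_eq_polystochastic hν₀ k ▸ isAnalyticCenter_polystochastic hν₀ k)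
    fun J => ⟨le_rfl, le_rfl⟩
  rw [transportPolytope_eq_polystochastic hν₀, gaussianFormula_polystochastic hk₀,
    Fin.prod_const, Fin.sum_const, smul_eq_mul, abs_sub_comm] at h
  set G := Real.exp ((k : ℝ) ^ ν) / (2 * Real.pi) ^ (((ν : ℝ) * k - ν + 1) / 2)
  have hG : 0 < G := by positivity
  rw [Real.dist_eq, div_sub_one hG.ne', abs_div, abs_of_pos hG, div_lt_iff₀ hG]
  exact h.trans_lt (mul_lt_mul_of_pos_right (half_lt_self hε) hG)

end Polystochastic

end GaussVol

end

theorem mainTheorem8_general (ν : ℕ) (hν : 2 ≤ ν) :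
    (∀ a b δ Δ : ℝ, 0 < a → 0 < δ →
      ∃ c C : ℝ, 0 < c ∧ 0 < C ∧
        ∀ (n : ℕ) (k : Fin ν → ℕ) (z : EuclideanSpace ℝ (GaussVol.Cell k)),
          (∀ i, 0 < k i) → (∀ i, a * n ≤ k i ∧ (k i : ℝ) ≤ b * n) →
          (∀ J, δ ≤ z J ∧ z J ≤ Δ) →
          ∃ l : ℝ,
            GaussVol.IsSmallestEigenvalue (GaussVol.momentForm (GaussVol.sectionMatrix k) z) l ∧
            c * (n : ℝ) ^ (ν - 2) ≤ l ∧ l ≤ C * (n : ℝ) ^ (ν - 2)) ∧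
    (4 ≤ ν → ∀ a b δ Δ : ℝ, 0 < a → 0 < δ →
      ∀ ε : ℝ, 0 < ε → ∃ n₀ : ℕ,
        ∀ (n : ℕ) (k : Fin ν → ℕ) (N : ℝ) (β : (i : Fin ν) → Fin (k i) → ℝ)
          (z : EuclideanSpace ℝ (GaussVol.Cell k)),
          n₀ ≤ n →
          (∀ i, 0 < k i) → (∀ i, a * n ≤ k i ∧ (k i : ℝ) ≤ b * n) →
          GaussVol.IsAnalyticCenter (GaussVol.transportPolytope k N β) z →
          (∀ J, δ ≤ z J ∧ z J ≤ Δ) →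
          |GaussVol.gaussianFormula (GaussVol.sectionMatrix k) z -
              GaussVol.vol ((∏ i, k i) - ((∑ i, (k i - 1)) + 1))
                (GaussVol.transportPolytope k N β)| ≤
            ε * GaussVol.vol ((∏ i, k i) - ((∑ i, (k i - 1)) + 1))
              (GaussVol.transportPolytope k N β)) ∧
    (∀ k : ℕ,
      GaussVol.IsAnalyticCenter (GaussVol.polystochastic ν k) (WithLp.toLp 2 fun _ => 1)) ∧
    (4 ≤ ν →
      Tendsto (fun k : ℕ =>
        GaussVol.vol (k ^ ν - (ν * (k - 1) + 1)) (GaussVol.polystochastic ν k) /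
          (Real.exp ((k : ℝ) ^ ν) / (2 * Real.pi) ^ (((ν : ℝ) * k - ν + 1) / 2)))
        atTop (𝓝 1)) :=
  ⟨fun _ b _ Δ ha hδ => GaussVol.exists_forall_isSmallestEigenvalue_bounds hν b Δ ha hδ,
    fun hν₄ _ b _ Δ ha hδ _ hε =>
      GaussVol.exists_forall_abs_gaussianFormula_sub_vol_le_mul_vol hν₄ b Δ ha hδ hε,
    GaussVol.isAnalyticCenter_polystochastic (two_pos.trans_le hν),
    GaussVol.tendsto_vol_polystochastic_div⟩

theorem mainTheorem8 (ν : ℕ) (hν : 2 ≤ ν) :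
    -- the smallest eigenvalue of `q` is of the order `n ^ (ν - 2)`
    (∀ a b δ Δ : ℝ, 0 < a → 0 < δ →
      ∃ c C : ℝ, 0 < c ∧ 0 < C ∧
        ∀ (n : ℕ) (k : Fin ν → ℕ) (N : ℝ) (β : (i : Fin ν) → Fin (k i) → ℝ)
          (z : EuclideanSpace ℝ (GaussVol.Cell k)),
          (∀ i, 1 < k i) → (∀ i, a * n ≤ k i ∧ (k i : ℝ) ≤ b * n) →
          (∀ i j, 0 < β i j) → (∀ i, ∑ j, β i j = N) →
          GaussVol.IsAnalyticCenter (GaussVol.transportPolytope k N β) z →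
          (∀ J, δ ≤ z J ∧ z J ≤ Δ) →
          ∃ l : ℝ,
            GaussVol.IsSmallestEigenvalue (GaussVol.momentForm (GaussVol.sectionMatrix k) z) l ∧
            c * (n : ℝ) ^ (ν - 2) ≤ l ∧ l ≤ C * (n : ℝ) ^ (ν - 2)) ∧
    -- for `ν ≥ 5` the relative error of the Gaussian formula tends to `0`
    (5 ≤ ν → ∀ a b δ Δ : ℝ, 0 < a → 0 < δ →
      ∀ ε : ℝ, 0 < ε → ∃ n₀ : ℕ,
        ∀ (n : ℕ) (k : Fin ν → ℕ) (N : ℝ) (β : (i : Fin ν) → Fin (k i) → ℝ)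
          (z : EuclideanSpace ℝ (GaussVol.Cell k)),
          n₀ ≤ n →
          (∀ i, 1 < k i) → (∀ i, a * n ≤ k i ∧ (k i : ℝ) ≤ b * n) →
          (∀ i j, 0 < β i j) → (∀ i, ∑ j, β i j = N) →
          GaussVol.IsAnalyticCenter (GaussVol.transportPolytope k N β) z →
          (∀ J, δ ≤ z J ∧ z J ≤ Δ) →
          |GaussVol.gaussianFormula (GaussVol.sectionMatrix k) z -
              GaussVol.vol ((∏ i, k i) - ((∑ i, (k i - 1)) + 1)) (GaussVol.transportPolytope k N β)| ≤
            ε * GaussVol.vol ((∏ i, k i) - ((∑ i, (k i - 1)) + 1))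
              (GaussVol.transportPolytope k N β)) ∧
    -- polystochastic tensors
    (∀ k : ℕ, 1 < k →
      GaussVol.IsAnalyticCenter (GaussVol.polystochastic ν k) (WithLp.toLp 2 fun _ => 1)) ∧
    (5 ≤ ν →
      Tendsto (fun k : ℕ =>
        GaussVol.vol (k ^ ν - (ν * (k - 1) + 1)) (GaussVol.polystochastic ν k) /
          (Real.exp ((k : ℝ) ^ ν) / (2 * Real.pi) ^ (((ν : ℝ) * k - ν + 1) / 2)))
        atTop (𝓝 1)) := by
  obtain ⟨heigenvalue, hvolume, hcenter, htendsto⟩ := mainTheorem8_general ν hν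
  refine ⟨fun a b δ Δ ha hδ => ?_, fun hν₅ a b δ Δ ha hδ ε hε => ?_, fun k _ => hcenter k,
    fun hν₅ => htendsto (Nat.le_of_succ_le hν₅)⟩
  · obtain ⟨c, C, hc, hC, h⟩ := heigenvalue a b δ Δ ha hδ
    exact ⟨c, C, hc, hC, fun n k _ _ z hk hab _ _ _ hz =>
      h n k z (fun i => Nat.zero_lt_of_lt (hk i)) hab hz⟩
  · obtain ⟨n₀, h⟩ := hvolume (Nat.le_of_succ_le hν₅) a b δ Δ ha hδ ε hε
    exact ⟨n₀, fun n k N β z hn hk hab _ _ hz =>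
      h n k N β z hn (fun i => Nat.zero_lt_of_lt (hk i)) hab hz⟩
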